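/- **Kinematics.** Let $\mathcal K$ be a finite nonempty set labelling positive helicity gravitons, and let $1$ be a negative helicity graviton. Each $a\in\{1\}\cup\mathcal K$ has spinors $|a),|a]\in\mathbb C^2$ and null momentum $a=|a)[a|$. Write $(\lambda\mu)$, $[\lambda\mu]$ for the antisymmetric contractions, and $P^2=\frac12P^{AA'}P_{AA'}$, so that $(i+j)^2=(ij)[ij]$. The sandwiches $(\lambda|P|\mu]$ and $(\lambda|P|Q|\mu)$ are linear in the momenta, with $(\lambda|i|\mu]=(\lambda i)[i\mu]$ and $(\lambda|i|j|\mu)=(\lambda i)[ij](j\mu)$. A subset of $\mathcal K$ also denotes the sum of its momenta. The reference spinor of the positive gravitons is $q=|1)$, that of the negative ones is $p$. Put $\Box=(1+\mathcal K)^2$. **Currents.** Define $J(i)=(qi)^{-4}$ and, for $|S|\ge2$, $$J(S)=\frac1{S^2}\sum_{\{I,S\setminus I\}}(q|I|S\setminus I|q)^2J(I)J(S\setminus I)$$ over unordered splittings of $S$ into two nonempty parts. For nonempty $S$ define $$J(1|S)=\frac1{(1+S)^2}\Big(\frac{(q|S|p]^2}{[1p]^2}J(S)+\sum_{\emptyset\ne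 I\subsetneq S}(q|I|S\setminus I|q)^2J(1|I)J(S\setminus I)\Big).$$ Put $J(1|S)_{ABA'B'}=q_Aq_B(q|1+S|_{A'}(q|1+S|_{B'}J(1|S)$. **Trees.** Sums over $\Gamma$ run over the spanning trees of the complete graph on $\mathcal K$, $\alpha_i$ is the valency of $i$ in $\Gamma$, and $$J(\Gamma)=\prod_i(qi)^{2\alpha_i-4}\prod_{\langle jk\rangle\in\Gamma}\frac{[jk]}{(jk)}.$$ For a subtree $\Gamma_I\subseteq\Gamma$ with vertex set $I$ put $$\phi(\Gamma_{\{i\}})=\frac{(qi)[ip]^2}{[1i][1p]^2},\qquad \phi(\Gamma_{\{i,j\}})=\frac{(q|i|j|q)(q|j|i|q)}{(1+i)^2(1+j)^2(1+i+j)^2}.$$ For $|I|\ge3$, let $E$ be the number of leaves of $\Gamma_I$, $\Psi$ the set of its non-leaves, and $\delta_1,\dots,\delta_{E-2}$ any enumeration of the multiset $\Delta$ that contains each vertex of valency $\alpha>2$ in $\Gamma_I$ exactly $\alpha-2$ times. With $\Psi_j=\Psi+\eta_1+\dots+\eta_j$, put $$\phi(\Gamma_I)=\frac1{(1+I)^2}\sum_{\eta}\frac{(q|\eta_1|\Psi|q)}{(1+\Psi)^2}\prod_{j=1}^{E-2}\frac{(q|\eta_{j+1}|1+\Psi_j|\delta_j)}{(1+\Psi_j)^2(q\delta_j)}\cdot\frac{(q|\eta_E|\Psi_{E-1}|q)}{(1+\Psi_{E-1})^2},$$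 where $\eta=(\eta_1,\dots,\eta_E)$ runs over all orderings of the leaves. Let $\Phi(\Gamma)=\sum_{\Gamma_I\subseteq\Gamma}\phi(\Gamma_I)$, over all subtrees. **On-shell point.** Let the kinematics $x_0$ be such that $0:=-(1+\mathcal K)=|0)[0|$ is null. Assume that $x_0$ is generic: $[1p]$, $[0p]$, $(01)$, $(0i)$, $(1i)$ for $i\in\mathcal K$, $S^2$ for $S\subseteq\mathcal K$ with $|S|\ge2$, and $(1+S)^2$ for $\emptyset\ne S\subsetneq\mathcal K$ are all nonzero. All limits below are over kinematics tending to $x_0$ with $\Box\ne0$, with $p$, $|0)$ and $|0]$ fixed; such kinematics exist arbitrarily close to $x_0$. **Claim.** 1. Only the top term has a pole. For every spanning tree $\Gamma$ and every proper subtree $\Gamma_I$, $\Box\,\phi(\Gamma_I)\to0$; hence $\Box\,(\Phi(\Gamma)-\phi(\Gamma))\to0$. Moreover $\Box\,\big(J(1|\mathcal K)-\sum_\Gamma\phi(\Gamma)J(\Gamma)\big)\to0$. 2. If $|\mathcal K|\ge2$, then for every spanning tree $\Gamma$ $$\Box\,\phi(\Gamma)\to(01)^2\prod_{\eta\text{ leaf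 of }\Gamma}\frac{(1\eta)}{(0\eta)}\prod_{\delta\in\Delta}\frac{(0\delta)}{(1\delta)}.$$ 3. Both $(01)^4\sum_\Gamma\Box\,\phi(\Gamma)J(\Gamma)$ and the amputated current contracted with the negative helicity polarisation of graviton $0$, $\epsilon_-^{ABA'B'}(0)\,\Box\,J(1|\mathcal K)_{ABA'B'}$ with $\epsilon_-^{ABA'B'}(0)=0^A0^Bp^{A'}p^{B'}/[0p]^2$, tend to $$A_{MHV}(01|\mathcal K)=(01)^6\sum_{\Gamma}\prod_{i\in\mathcal K}(0i)^{\alpha_i-2}(1i)^{\alpha_i-2}\prod_{\langle jk\rangle\in\Gamma}\frac{[jk]}{(jk)}$$ (right-hand side evaluated at $x_0$). -/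

import Mathlib

open Filter Topology

namespace GravityMHV

/-- Two-component spinors (unprimed or primed). -/
abbrev Spinor := Fin 2 → ℂ

/-- The contraction `λ^A μ_A`, written `(λ μ)` for unprimed and `[λ μ]` for primed spinors. -/
def bracket (l m : Spinor) : ℂ := l 0 * m 1 - l 1 * m 0

/-- The spinor with its index raised, so that `∑ A, raise l A * m A = (l m)`. -/
def raise (l : Spinor) : Spinor := ![-l 1, l 0]

/-- Complex four-vectors `P_{AA'}`. -/
abbrev Momentum := Matrix (Fin 2) (Fin 2) ℂ

/-- `P ^ 2 = (1/2) P^{AA'} P_{AA'}`; for two null momenta, `(1+2)^2 = (12)[12]`. -/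
noncomputable def sqr (P : Momentum) : ℂ :=
  (1 / 2) * ∑ A, ∑ A', raise (fun B => raise (P B) A') A * P A A'

/-- The primed spinor `(l|P|_{A'} = l^A P_{AA'}`. -/
def slashLeft (l : Spinor) (P : Momentum) : Spinor := fun A' => bracket l (fun A => P A A')

/-- The primed spinor `P|m)_{A'} = P_{A'}^A m_A`. -/
def slashRight (P : Momentum) (m : Spinor) : Spinor := fun A' => bracket (fun A => P A A') m

/-- `(l|P|m]`, for `l` unprimed and `m` primed. -/
def sandwich₁ (l : Spinor) (P : Momentum) (m : Spinor) : ℂ := bracket (slashLeft l P) m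

/-- `(l|P|Q|m)`, for `l` and `m` unprimed; for null momenta, `(l|i|j|m) = (l i)[i j](j m)`. -/
def sandwich₂ (l : Spinor) (P Q : Momentum) (m : Spinor) : ℂ :=
  bracket (slashLeft l P) (slashRight Q m)

/-- The null momentum `|l)[m|`. -/
def nullMom (l m : Spinor) : Momentum := Matrix.vecMulVec l m

/-- Kinematic data: an unprimed and a primed momentum spinor for the negative helicity graviton
`1` (the index `none`) and for every positive helicity graviton `i : V` (the index `some i`). -/
abbrev Kinematics (V : Type*) := Option V → Spinor × Spinor

section

variable {V : Type*} (x : Kinematics V)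

/-- The unprimed momentum spinor `|1)`. It is also the reference spinor `q` of all the positive
helicity gravitons. -/
def one : Spinor := (x none).1

/-- The primed momentum spinor `|1]`. -/
def oneT : Spinor := (x none).2

/-- The unprimed momentum spinor `|i)`. -/
def ang (i : V) : Spinor := (x (some i)).1

/-- The primed momentum spinor `|i]`. -/
def squ (i : V) : Spinor := (x (some i)).2

/-- The total momentum of the positive helicity gravitons in `S`. -/
def mom (S : Finset V) : Momentum := ∑ i ∈ S, nullMom (ang x i) (squ x i)

/-- The total momentum `1 + S` of the graviton `1` and the gravitons in `S`. -/
def mom₁ (S : Finset V) : Momentum := nullMom (one x) (oneT x) + mom x S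

/-! ### Berends-Giele currents -/

variable [DecidableEq V]

/-- The scalar part `J(S)` of the all-plus current, defined by its Berends-Giele recursion:
`J(i) = (q i)^{-4}`, and `J(S) = (1/S^2) ∑ (q|I|S∖I|q)^2 J(I) J(S∖I)`, with a sum over
the unordered splittings of `S` into two nonempty parts (half of the sum over ordered ones). -/
noncomputable def plusCurrent (S : Finset V) : ℂ :=
  if S.card = 1 then ∑ i ∈ S, (bracket (one x) (ang x i) ^ 4)⁻¹
  else (sqr (mom x S))⁻¹ * ((1 / 2) * ∑ I ∈ (S.ssubsets.erase ∅).attach,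
    sandwich₂ (one x) (mom x I.1) (mom x (S \ I.1)) (one x) ^ 2
      * plusCurrent I.1 * plusCurrent (S \ I.1))
termination_by S.card
decreasing_by
  · exact Finset.card_lt_card (Finset.mem_ssubsets.1 (Finset.mem_erase.1 I.2).2)
  · have h := Finset.mem_erase.1 I.2
    exact Finset.card_lt_card (Finset.sdiff_ssubset (Finset.mem_ssubsets.1 h.2).subset
      (Finset.nonempty_iff_ne_empty.2 h.1))

/-- The scalar part `J(1|S)` of the all-but-one-plus current, defined by its Berends-Giele
recursion
`J(1|S) = (1/(1+S)^2) ((q|S|p]^2/[1p]^2 J(S) + ∑ (q|I|S∖I|q)^2 J(1|I) J(S∖I))`,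
with a sum over all proper nonempty subsets `I` of `S`. The spinor `p` is the
reference spinor of the graviton `1`. -/
noncomputable def oneMinusCurrent (p : Spinor) (S : Finset V) : ℂ :=
  (sqr (mom₁ x S))⁻¹ *
    (sandwich₁ (one x) (mom x S) p ^ 2 / bracket (oneT x) p ^ 2 * plusCurrent x S
      + ∑ I ∈ (S.ssubsets.erase ∅).attach,
        sandwich₂ (one x) (mom x I.1) (mom x (S \ I.1)) (one x) ^ 2
          * oneMinusCurrent p I.1 * plusCurrent x (S \ I.1))
termination_by S.card
decreasing_by
  exact Finset.card_lt_card (Finset.mem_ssubsets.1 (Finset.mem_erase.1 I.2).2)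

/-- The all-but-one-plus current
`J(1|S)_{ABA'B'} = q_A q_B (q|1+S|_{A'} (q|1+S|_{B'} J(1|S)`. -/
noncomputable def currentTensor (p : Spinor) (S : Finset V) (A B A' B' : Fin 2) : ℂ :=
  one x A * one x B * slashLeft (one x) (mom₁ x S) A' * slashLeft (one x) (mom₁ x S) B'
    * oneMinusCurrent x p S

end

/-- The polarisation tensor `ε₋^{ABA'B'} = k^A k^B p^{A'} p^{B'} / [pk]^2` of a negative
helicity graviton with momentum `|k)[kt|` and reference spinor `p`. -/
noncomputable def polMinus (k kt p : Spinor) (A B A' B' : Fin 2) : ℂ :=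
  raise k A * raise k B * raise p A' * raise p B' / bracket p kt ^ 2

/-- The contraction of the amputated current `(1+K)^2 J(1|K)_{ABA'B'}` with the negative helicity
polarisation `ε₋^{ABA'B'}(0)` of the graviton `0` with momentum `|z)[zt|`. -/
noncomputable def amputated {V : Type*} [Fintype V] [DecidableEq V] (z zt p : Spinor)
    (x : Kinematics V) : ℂ :=
  ∑ A, ∑ B, ∑ A', ∑ B', polMinus z zt p A B A' B' *
    (sqr (mom₁ x Finset.univ) * currentTensor x p Finset.univ A B A' B')

/-! ### Trees -/

section

open scoped Classical

variable {V : Type*}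

/-- The number of edges of the subgraph of `Γ` on `I` at the vertex `i`. -/
noncomputable def deg (Γ : SimpleGraph V) (I : Finset V) (i : V) : ℕ :=
  (I.filter (fun j => Γ.Adj i j)).card

/-- For a tree `Γ`, its subtrees are given by the nonempty vertex sets on which it is connected. -/
def IsSubtree (Γ : SimpleGraph V) (I : Finset V) : Prop := (Γ.induce (I : Set V)).Connected

/-- The ends (leaves) of the subtree on `I`. -/
noncomputable def ends (Γ : SimpleGraph V) (I : Finset V) : Finset V :=
  I.filter (fun i => deg Γ I i = 1)

/-- The stem `Ψ` of the subtree on `I`. -/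
noncomputable def stem (Γ : SimpleGraph V) (I : Finset V) : Finset V :=
  I.filter (fun i => deg Γ I i ≠ 1)

/-- The multiset `Δ`: every vertex of valency `α > 2` is taken `α - 2` times. -/
noncomputable def branching (Γ : SimpleGraph V) (I : Finset V) : Multiset V :=
  ∑ i ∈ I, Multiset.replicate (deg Γ I i - 2) i

/-- `δ 1, …, δ (E - 2)` is an enumeration of the multiset `Δ` of the subtree on `I`. -/
def Enumerates (δ : ℕ → V) (Γ : SimpleGraph V) (I : Finset V) : Prop :=
  (Finset.Icc 1 ((ends Γ I).card - 2)).val.map δ = branching Γ I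

/-- The vertices in `Ψ + η_0 + … + η_{t-1}`, for an ordering `η` of the ends. -/
noncomputable def grown (Γ : SimpleGraph V) (I : Finset V)
    (η : Fin (ends Γ I).card ≃ ends Γ I) (t : Fin (ends Γ I).card) : Finset V :=
  stem Γ I ∪ (Finset.univ.filter (fun s => s < t)).image (fun s => (η s : V))

/-- The contribution `φ(Γ_I)` of the subtree of `Γ` on `I`.
For a single vertex, `φ = (q i)[i p]^2 / ([1 i][1 p]^2)`.
For two vertices, `φ = (q|i|j|q)(q|j|i|q) / ((1+i)^2 (1+j)^2 (1+i+j)^2)`.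
For three or more vertices, `φ` is `1/(1+I)^2` times a sum over the orderings
`η_0, …, η_{E-1}` of the ends, of a product of one factor for every end `η_t`. With
`S = Ψ + η_0 + … + η_{t-1}`, it is `(q|η_t|S|q)/(1+S)^2` for the first and for the last end, and
`(q|η_t|1+S|δ_t)/((1+S)^2 (q δ_t))` for the others. -/
noncomputable def phi (x : Kinematics V) (p : Spinor) (Γ : SimpleGraph V) (δ : ℕ → V)
    (I : Finset V) : ℂ :=
  if I.card = 1 then
    ∑ i ∈ I, bracket (one x) (ang x i) * bracket (squ x i) p ^ 2 /
      (bracket (oneT x) (squ x i) * bracket (oneT x) p ^ 2)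
  else if I.card = 2 then
    (sqr (mom₁ x I))⁻¹ *
      ∏ i ∈ I, sandwich₂ (one x) (mom x {i}) (mom x (I.erase i)) (one x) / sqr (mom₁ x {i})
  else
    (sqr (mom₁ x I))⁻¹ *
      ∑ η : Fin (ends Γ I).card ≃ ends Γ I, ∏ t : Fin (ends Γ I).card,
        if (t : ℕ) = 0 ∨ (t : ℕ) + 1 = (ends Γ I).card then
          sandwich₂ (one x) (mom x {(η t : V)}) (mom x (grown Γ I η t)) (one x) /
            sqr (mom₁ x (grown Γ I η t))
        else
          sandwich₂ (one x) (mom x {(η t : V)}) (mom₁ x (grown Γ I η t)) (ang x (δ t)) /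
            (sqr (mom₁ x (grown Γ I η t)) * bracket (one x) (ang x (δ t)))

variable [Fintype V]

/-- `Φ(Γ)`, the sum of `φ(Γ_I)` over all the subtrees `Γ_I` of `Γ`, where `δ I` is the
enumeration used for the subtree on `I`. -/
noncomputable def Phi (x : Kinematics V) (p : Spinor) (Γ : SimpleGraph V)
    (δ : Finset V → ℕ → V) : ℂ :=
  ∑ I ∈ Finset.univ.filter (IsSubtree Γ), phi x p Γ (δ I) I

/-- The factor `[jk]/(jk)` of an edge. -/
noncomputable def edgeFactor (x : Kinematics V) : Sym2 V → ℂ :=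
  Sym2.lift ⟨fun j k => bracket (squ x j) (squ x k) / bracket (ang x j) (ang x k), by
    intro j k
    have h1 : bracket (squ x j) (squ x k) = -bracket (squ x k) (squ x j) := by
      simp only [bracket]; ring
    have h2 : bracket (ang x j) (ang x k) = -bracket (ang x k) (ang x j) := by
      simp only [bracket]; ring
    simp only [h1, h2, neg_div_neg_eq]⟩

/-- `J(Γ) = ∏_i (q i)^{2 α_i - 4} ∏_{⟨jk⟩} [jk]/(jk)`. -/
noncomputable def treeWeight (x : Kinematics V) (Γ : SimpleGraph V) : ℂ :=
  (∏ i, bracket (one x) (ang x i) ^ (2 * (Γ.degree i : ℤ) - 4)) *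
    ∏ e ∈ Γ.edgeFinset, edgeFactor x e

/-- The spanning trees of the complete graph on `V`. -/
noncomputable def spanningTrees (V : Type*) [Fintype V] : Finset (SimpleGraph V) :=
  Finset.univ.filter (fun Γ => Γ.IsTree)

/-- `(01)^6 ∑_Γ ∏_i (0i)^{α_i - 2} (1i)^{α_i - 2} ∏_{⟨jk⟩} [jk]/(jk)`, with `|0) = z`. -/
noncomputable def mhvFormula (x : Kinematics V) (z : Spinor) : ℂ :=
  bracket z (one x) ^ 6 * ∑ Γ ∈ spanningTrees V,
    (∏ i, bracket z (ang x i) ^ ((Γ.degree i : ℤ) - 2) *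
      bracket (one x) (ang x i) ^ ((Γ.degree i : ℤ) - 2)) *
    ∏ e ∈ Γ.edgeFinset, edgeFactor x e

end

/-- Off-shell kinematics, `(1+K)^2 ≠ 0`, tending to the on-shell kinematics `x₀`. -/
noncomputable def offShell {V : Type*} [Fintype V] (x₀ : Kinematics V) : Filter (Kinematics V) :=
  𝓝[{x | sqr (mom₁ x Finset.univ) ≠ 0}] x₀

end GravityMHV

open GravityMHV

/-!
The current is expanded over trees, and the residue of each tree is computed separately, with
the recursion of the currents on one side and with the sum over orderings on the other.

All limits reduce to algebra at the on-shell point `x₀`: after multiplication by `(1+K)^2`,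
both the current and `φ(Γ)` are continuous there, since the propagators that remain belong to
proper nonempty subsets. Write `r k = (0k)/(1k)`. By the Schouten identity, the edge factor
`(ij)/((qi)(qj))` is the increment of `r/(q0)` along the edge `ij`.

*Trees.* In the recursion, one of the two factors `(q|I|S∖I|q)` joins a tree on `I` and a tree on
`S∖I` by an edge (`sandwich₂_sq_mul_sum_treesOn`). Hence the currents are sums over trees of
quantities that satisfy a recursion over the cuts of a single tree. For the all-plus current, the
increments along the path between two vertices telescope, and the quantity of each tree is
`J(Γ)` (`plusCurrent_eq_sum`).

*The residue of the current.* For a single tree, the recursion need not be solved off shell. It is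
linear, and it is enough to solve the transposed recursion, in which the graviton `0`
propagates in the background of the gravitons outside a subtree `I`. On shell, momentum
conservation makes its solution elementary: it is `outerWeight`, the product of `r v ^ (α - 2)` over
the vertices outside `I` and of `r i - r j` over the edges `ij` that leave `I`
(`sqr_mul_outerWeight`). The residue is the sum of the source `(q|I|p]^2/[1p]^2` against these
weights. As the subtrees through two vertices `k`, `l` have total weight `r k * r l`, up
to a common factor (`GrowsTo.sum_outerWeight`), it is a perfect square, `(0|K|p]^2/[1p]^2 = (01)^2`,
times the product of all `r v ^ (α - 2)` (`treeNumerator_onshell`). The sums over subtrees are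
evaluated by growing the tree leaf by leaf.

*The residue of `φ(Γ)`.* The sum over the orderings of the ends factorises on shell, for
arbitrary spinors in place of the `δ t`. By induction on the number of ends, the sum over the first
end to be added to `1+Ψ` produces `(0|1+Ψ|1+Ψ|d)`, which cancels the
propagator `1/(1+Ψ)^2` (`sum_orderings_onshell`). The result is again `(01)^2` times the product of
all `r v ^ (α - 2)`, so that both residues agree tree by tree, and with the MHV amplitude.
-/

namespace GravityMHV

/-! ### Subtrees and leaves -/

section

open scoped Classical

variable {V : Type*}

/-- Connectedness in terms of cuts: every proper nonempty part of `S` is left by an edge. -/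
theorem isSubtree_iff (Γ : SimpleGraph V) (S : Finset V) :
    IsSubtree Γ S ↔ S.Nonempty ∧ ∀ A ⊆ S, A.Nonempty → A ≠ S →
      ∃ i ∈ A, ∃ j ∈ S, j ∉ A ∧ Γ.Adj i j := by
  constructor
  · intro h
    refine ⟨?_, ?_⟩
    · obtain ⟨⟨v, hv⟩⟩ := h.nonempty
      exact ⟨v, hv⟩
    · intro A hA ⟨a, ha⟩ hne
      obtain ⟨b, hbS, hbA⟩ : ∃ b ∈ S, b ∉ A := by
        by_contra! hc
        exact hne (Finset.Subset.antisymm hA hc)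
      obtain ⟨w⟩ := h.preconnected ⟨a, hA ha⟩ ⟨b, hbS⟩
      obtain ⟨d, -, h1, h2⟩ := w.exists_boundary_dart {v | (v : V) ∈ A} ha hbA
      exact ⟨d.fst, h1, d.snd, d.snd.2, h2, d.adj⟩
  · rintro ⟨⟨v, hv⟩, h⟩
    have key : ∀ w : (S : Set V), (Γ.induce (S : Set V)).Reachable ⟨v, hv⟩ w := by
      set A : Finset V := S.filter
        (fun u => ∃ hu : u ∈ S, (Γ.induce (S : Set V)).Reachable ⟨v, hv⟩ ⟨u, hu⟩) with hA
      have hvA : v ∈ A := by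
        rw [hA, Finset.mem_filter]
        exact ⟨hv, hv, SimpleGraph.Reachable.refl _⟩
      have hAS : A = S := by
        by_contra hne
        obtain ⟨i, hi, j, hj, hjA, hadj⟩ := h A (Finset.filter_subset _ _) ⟨v, hvA⟩ hne
        rw [hA, Finset.mem_filter] at hi hjA
        obtain ⟨hi, hi', hr⟩ := hi
        refine hjA ⟨hj, hj, hr.trans (SimpleGraph.Adj.reachable ?_)⟩
        exact hadj
      intro ⟨w, hw⟩
      have hwA : w ∈ A := hAS ▸ hw
      rw [hA, Finset.mem_filter] at hwA
      exact hwA.2.2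
    have : Nonempty (S : Set V) := ⟨⟨v, hv⟩⟩
    exact ⟨fun a b => (key a).symm.trans (key b)⟩

theorem IsSubtree.nonempty {Γ : SimpleGraph V} {S : Finset V} (h : IsSubtree Γ S) :
    S.Nonempty := ((isSubtree_iff Γ S).1 h).1

theorem isSubtree_singleton (Γ : SimpleGraph V) (v : V) : IsSubtree Γ {v} := by
  rw [isSubtree_iff]
  refine ⟨⟨v, by simp⟩, fun A hA hne hA' => ?_⟩
  exact absurd ((Finset.subset_singleton_iff.1 hA).resolve_left hne.ne_empty) hA'

/-- Being a subtree on `S` only depends on the edges inside `S`. -/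
theorem IsSubtree.congr {Γ Γ' : SimpleGraph V} {S : Finset V}
    (h : ∀ i ∈ S, ∀ j ∈ S, (Γ.Adj i j ↔ Γ'.Adj i j)) : IsSubtree Γ S ↔ IsSubtree Γ' S := by
  rw [isSubtree_iff, isSubtree_iff]
  refine and_congr_right fun _ => forall_congr' fun A => forall_congr' fun hA => ?_
  refine forall_congr' fun _ => forall_congr' fun _ => ?_
  constructor
  · rintro ⟨i, hi, j, hj, hjA, ha⟩
    exact ⟨i, hi, j, hj, hjA, (h i (hA hi) j hj).1 ha⟩
  · rintro ⟨i, hi, j, hj, hjA, ha⟩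
    exact ⟨i, hi, j, hj, hjA, (h i (hA hi) j hj).2 ha⟩

/-- The union of two subtrees joined by an edge is connected. -/
theorem IsSubtree.union {Γ : SimpleGraph V} {I C : Finset V} (hI : IsSubtree Γ I)
    (hC : IsSubtree Γ C) {i j : V} (hi : i ∈ I) (hj : j ∈ C) (hij : Γ.Adj i j) :
    IsSubtree Γ (I ∪ C) := by
  rw [isSubtree_iff] at *
  refine ⟨hI.1.mono Finset.subset_union_left, fun A hA hne hneq => ?_⟩
  by_cases h1 : (A ∩ I).Nonempty ∧ A ∩ I ≠ I
  · obtain ⟨a, ha, b, hb, hbA, hab⟩ := hI.2 _ Finset.inter_subset_right h1.1 h1.2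
    simp only [Finset.mem_inter, not_and] at ha hbA
    exact ⟨a, ha.1, b, Finset.mem_union_left _ hb, fun h => hbA h hb, hab⟩
  by_cases h2 : (A ∩ C).Nonempty ∧ A ∩ C ≠ C
  · obtain ⟨a, ha, b, hb, hbA, hab⟩ := hC.2 _ Finset.inter_subset_right h2.1 h2.2
    simp only [Finset.mem_inter, not_and] at ha hbA
    exact ⟨a, ha.1, b, Finset.mem_union_right _ hb, fun h => hbA h hb, hab⟩
  have e1 : A ∩ I = ∅ ∨ I ⊆ A := by
    by_cases h : (A ∩ I).Nonempty
    · right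
      have : A ∩ I = I := by by_contra h'; exact h1 ⟨h, h'⟩
      exact Finset.inter_eq_right.1 this
    · left; exact Finset.not_nonempty_iff_eq_empty.1 h
  have e2 : A ∩ C = ∅ ∨ C ⊆ A := by
    by_cases h : (A ∩ C).Nonempty
    · right
      have : A ∩ C = C := by by_contra h'; exact h2 ⟨h, h'⟩
      exact Finset.inter_eq_right.1 this
    · left; exact Finset.not_nonempty_iff_eq_empty.1 h
  rcases e1 with e1 | e1 <;> rcases e2 with e2 | e2
  · exfalso
    obtain ⟨a, ha⟩ := hne
    rcases Finset.mem_union.1 (hA ha) with h | h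
    · exact Finset.notMem_empty a (e1 ▸ Finset.mem_inter.2 ⟨ha, h⟩)
    · exact Finset.notMem_empty a (e2 ▸ Finset.mem_inter.2 ⟨ha, h⟩)
  · exact ⟨j, e2 hj, i, Finset.mem_union_left _ hi,
      fun h => Finset.notMem_empty i (e1 ▸ Finset.mem_inter.2 ⟨h, hi⟩), hij.symm⟩
  · exact ⟨i, e1 hi, j, Finset.mem_union_right _ hj,
      fun h => Finset.notMem_empty j (e2 ▸ Finset.mem_inter.2 ⟨h, hj⟩), hij⟩
  · exact absurd (Finset.Subset.antisymm hA (Finset.union_subset e1 e2)) hneq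

/-- The vertex `l` outside `S` is joined to `S` by a single edge, at the vertex `m` of `S`. -/
structure IsLeafAt (Γ : SimpleGraph V) (S : Finset V) (l m : V) : Prop where
  notMem : l ∉ S
  mem : m ∈ S
  adj_iff : ∀ v ∈ S, Γ.Adj l v ↔ v = m

theorem IsLeafAt.isSubtree_insert_iff {Γ : SimpleGraph V} {S C : Finset V} {l m : V}
    (h : IsLeafAt Γ S l m) (hC : C ⊆ S) :
    IsSubtree Γ (insert l C) ↔ C = ∅ ∨ (m ∈ C ∧ IsSubtree Γ C) := by
  have hlC : l ∉ C := fun h' => h.notMem (hC h')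
  constructor
  · intro hcon
    rcases C.eq_empty_or_nonempty with rfl | hne
    · exact Or.inl rfl
    right
    rw [isSubtree_iff] at hcon
    have hm : m ∈ C := by
      obtain ⟨i, hi, j, hj, hjA, hadj⟩ := hcon.2 {l} (by simp) (by simp) (by
        obtain ⟨c, hc⟩ := hne
        intro h'
        have : c ∈ ({l} : Finset V) := h' ▸ Finset.mem_insert_of_mem hc
        rw [Finset.mem_singleton] at this
        exact hlC (this ▸ hc))
      rw [Finset.mem_singleton] at hi hjA
      subst hi
      have hjC := (Finset.mem_insert.1 hj).resolve_left hjA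
      exact (h.adj_iff j (hC hjC)).1 hadj ▸ hjC
    refine ⟨hm, (isSubtree_iff _ _).2 ⟨hne, fun A hA hAne hAC => ?_⟩⟩
    by_cases hmA : m ∈ A
    · obtain ⟨i, hi, j, hj, hjA, hadj⟩ := hcon.2 (insert l A) (Finset.insert_subset_insert _ hA)
        (by simp) (by
          intro h'
          apply hAC
          have := congrArg (fun T => T.erase l) h'
          simpa [Finset.erase_insert hlC, Finset.erase_insert (fun h' => hlC (hA h'))] using this)
      simp only [Finset.mem_insert, not_or] at hi hj hjA
      have hjC := hj.resolve_left hjA.1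
      rcases hi with rfl | hi
      · exact absurd ((h.adj_iff j (hC hjC)).1 hadj ▸ hmA) hjA.2
      · exact ⟨i, hi, j, hjC, hjA.2, hadj⟩
    · obtain ⟨i, hi, j, hj, hjA, hadj⟩ := hcon.2 A (hA.trans (Finset.subset_insert _ _))
        hAne (by
          intro h'
          exact hlC (hA (h' ▸ Finset.mem_insert_self _ _)))
      rcases Finset.mem_insert.1 hj with rfl | hjC
      · exact absurd ((h.adj_iff i (hC (hA hi))).1 hadj.symm ▸ hi) hmA
      · exact ⟨i, hi, j, hjC, hjA, hadj⟩
  · rintro (rfl | ⟨hm, hcon⟩)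
    · exact isSubtree_singleton Γ l
    · exact (isSubtree_singleton Γ l).union hcon (Finset.mem_singleton_self l) hm
        ((h.adj_iff m h.mem).2 rfl)

/-- `S` arises from `I` by adding leaves one after the other. -/
inductive GrowsTo (Γ : SimpleGraph V) (I : Finset V) : Finset V → Prop
  | refl : GrowsTo Γ I I
  | step {S : Finset V} {l m : V} : GrowsTo Γ I S → IsLeafAt Γ S l m → GrowsTo Γ I (insert l S)

theorem GrowsTo.subset {Γ : SimpleGraph V} {I S : Finset V} (h : GrowsTo Γ I S) : I ⊆ S := by
  induction h with
  | refl => exact subset_rfl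
  | step _ _ ih => exact ih.trans (Finset.subset_insert _ _)

theorem deg_insert {Γ : SimpleGraph V} {S : Finset V} {l : V} (hl : l ∉ S) (v : V) :
    deg Γ (insert l S) v = deg Γ S v + if Γ.Adj v l then 1 else 0 := by
  unfold deg
  rw [Finset.filter_insert]
  split_ifs with h
  · rw [Finset.card_insert_of_notMem]
    simp [hl]
  · rfl

theorem deg_congr {Γ Γ' : SimpleGraph V} {S : Finset V} {v : V}
    (h : ∀ j ∈ S, (Γ.Adj v j ↔ Γ'.Adj v j)) : deg Γ S v = deg Γ' S v := by
  unfold deg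
  congr 1
  exact Finset.filter_congr h

theorem sum_deg_insert {Γ : SimpleGraph V} {S : Finset V} {l : V} (hl : l ∉ S) :
    ∑ v ∈ insert l S, deg Γ (insert l S) v = ∑ v ∈ S, deg Γ S v + 2 * deg Γ S l := by
  rw [Finset.sum_insert hl, deg_insert hl, if_neg (Γ.irrefl)]
  simp only [deg_insert hl, Finset.sum_add_distrib]
  have : ∑ v ∈ S, (if Γ.Adj v l then 1 else 0) = deg Γ S l := by
    rw [← Finset.sum_filter, Finset.sum_const, smul_eq_mul, mul_one]
    unfold deg
    simp only [Γ.adj_comm]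
  rw [this]; ring

theorem deg_union {Γ : SimpleGraph V} {I C : Finset V} (h : Disjoint I C) (v : V) :
    deg Γ (I ∪ C) v = deg Γ I v + deg Γ C v := by
  unfold deg
  rw [Finset.filter_union, Finset.card_union_of_disjoint]
  exact Finset.disjoint_filter_filter h

theorem sum_deg_union {Γ : SimpleGraph V} {I C : Finset V} (h : Disjoint I C) :
    ∑ v ∈ I ∪ C, deg Γ (I ∪ C) v = ∑ v ∈ I, deg Γ I v + ∑ v ∈ C, deg Γ C v
      + 2 * ∑ v ∈ I, deg Γ C v := by
  have h2 : ∑ v ∈ C, deg Γ I v = ∑ v ∈ I, deg Γ C v := by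
    unfold deg
    simp only [Finset.card_filter]
    rw [Finset.sum_comm]
    simp only [Γ.adj_comm]
  rw [Finset.sum_union h]
  simp only [deg_union h, Finset.sum_add_distrib]
  rw [h2]; ring

/-- A connected set grows to a larger connected set by adding vertices that have
a neighbour in the set obtained so far: the number of edges grows accordingly, and every added
vertex is a leaf if it grows as little as possible. -/
theorem IsSubtree.two_mul_card_le_or_growsTo {Γ : SimpleGraph V} {I S : Finset V}
    (hI : I.Nonempty) (hS : IsSubtree Γ S) (hIS : I ⊆ S) :
    ∑ v ∈ I, deg Γ I v + 2 * S.card ≤ ∑ v ∈ S, deg Γ S v + 2 * I.card ∧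
    (∑ v ∈ S, deg Γ S v + 2 * I.card ≤ ∑ v ∈ I, deg Γ I v + 2 * S.card → GrowsTo Γ I S) := by
  -- the vertices of `S` are added to `I` one at a time
  suffices key : ∀ n : ℕ, ∀ A : Finset V, I ⊆ A → A ⊆ S → (S \ A).card = n →
      (∑ v ∈ I, deg Γ I v + 2 * A.card ≤ ∑ v ∈ A, deg Γ A v + 2 * I.card ∧
      (∑ v ∈ A, deg Γ A v + 2 * I.card ≤ ∑ v ∈ I, deg Γ I v + 2 * A.card → GrowsTo Γ I A)) →
      (∑ v ∈ I, deg Γ I v + 2 * S.card ≤ ∑ v ∈ S, deg Γ S v + 2 * I.card ∧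
      (∑ v ∈ S, deg Γ S v + 2 * I.card ≤ ∑ v ∈ I, deg Γ I v + 2 * S.card → GrowsTo Γ I S)) from
    key _ I subset_rfl hIS rfl ⟨le_rfl, fun _ => GrowsTo.refl⟩
  intro n
  induction n with
  | zero =>
    intro A _ hAS hc h
    have : S ⊆ A := Finset.sdiff_eq_empty_iff_subset.1 (Finset.card_eq_zero.1 hc)
    rwa [← Finset.Subset.antisymm hAS this]
  | succ n ih =>
    intro A hIA hAS hc h
    have hne : A ≠ S := by
      rintro rfl
      simp at hc
    obtain ⟨i, hi, l, hlS, hlA, hadj⟩ := ((isSubtree_iff _ _).1 hS).2 A hAS (hI.mono hIA) hne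
    have hpos : 1 ≤ deg Γ A l :=
      Finset.card_pos.2 ⟨i, Finset.mem_filter.2 ⟨hi, hadj.symm⟩⟩
    refine ih (insert l A) (hIA.trans (Finset.subset_insert _ _))
      (Finset.insert_subset hlS hAS) ?_ ?_
    · rw [Finset.sdiff_insert, Finset.card_erase_of_mem (Finset.mem_sdiff.2 ⟨hlS, hlA⟩), hc]
      rfl
    · rw [sum_deg_insert hlA, Finset.card_insert_of_notMem hlA]
      refine ⟨by omega, fun hle => ?_⟩
      have h1 : deg Γ A l = 1 := by omega
      refine GrowsTo.step (h.2 (by omega)) (m := i) ⟨hlA, hi, fun v hv => ?_⟩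
      obtain ⟨w, hw⟩ := Finset.card_eq_one.1 h1
      have hiw : i ∈ A.filter (fun j => Γ.Adj l j) := Finset.mem_filter.2 ⟨hi, hadj.symm⟩
      rw [hw, Finset.mem_singleton] at hiw
      constructor
      · intro hlv
        have hvw : v ∈ A.filter (fun j => Γ.Adj l j) := Finset.mem_filter.2 ⟨hv, hlv⟩
        rw [hw, Finset.mem_singleton] at hvw
        rw [hvw, hiw]
      · rintro rfl
        exact hadj.symm

theorem IsSubtree.two_mul_card_le {Γ : SimpleGraph V} {S : Finset V} (hS : IsSubtree Γ S) :
    2 * S.card ≤ ∑ v ∈ S, deg Γ S v + 2 := by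
  obtain ⟨v, hv⟩ := hS.nonempty
  have := (hS.two_mul_card_le_or_growsTo (I := {v}) (by simp) (by simpa using hv)).1
  simp at this
  omega

/-- `Γ` restricts to a tree on `S`: it is connected, and has `|S| - 1` edges there. -/
def IsTreeOn (Γ : SimpleGraph V) (S : Finset V) : Prop :=
  IsSubtree Γ S ∧ ∑ v ∈ S, deg Γ S v + 2 = 2 * S.card

theorem IsTreeOn.of_subset {Γ : SimpleGraph V} {I S : Finset V} (hS : IsTreeOn Γ S)
    (hI : IsSubtree Γ I) (hIS : I ⊆ S) : IsTreeOn Γ I := by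
  refine ⟨hI, ?_⟩
  have h1 := (hS.1.two_mul_card_le_or_growsTo hI.nonempty hIS).1
  have h2 := hI.two_mul_card_le
  have := hS.2
  omega

/-- A tree grows from any of its subtrees by adding leaves. -/
theorem IsTreeOn.growsTo {Γ : SimpleGraph V} {I S : Finset V} (hS : IsTreeOn Γ S)
    (hI : IsSubtree Γ I) (hIS : I ⊆ S) : GrowsTo Γ I S := by
  refine (hS.1.two_mul_card_le_or_growsTo hI.nonempty hIS).2 ?_
  have := (hS.of_subset hI hIS).2
  have := hS.2
  omega

theorem IsTreeOn.congr {Γ Γ' : SimpleGraph V} {S : Finset V}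
    (h : ∀ i ∈ S, ∀ j ∈ S, (Γ.Adj i j ↔ Γ'.Adj i j)) : IsTreeOn Γ S ↔ IsTreeOn Γ' S := by
  unfold IsTreeOn
  rw [IsSubtree.congr h, Finset.sum_congr rfl fun v hv => deg_congr (h v hv)]

theorem deg_univ [Fintype V] (Γ : SimpleGraph V) (v : V) :
    deg Γ Finset.univ v = Γ.degree v := by
  unfold deg
  rw [← SimpleGraph.card_neighborFinset_eq_degree, SimpleGraph.neighborFinset_eq_filter]

theorem isSubtree_univ_iff [Fintype V] (Γ : SimpleGraph V) :
    IsSubtree Γ Finset.univ ↔ Γ.Connected := by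
  unfold IsSubtree
  rw [Finset.coe_univ]
  exact (SimpleGraph.induceUnivIso Γ).connected_iff

theorem isTreeOn_univ_iff [Fintype V] (Γ : SimpleGraph V) :
    IsTreeOn Γ Finset.univ ↔ Γ.IsTree := by
  unfold IsTreeOn
  rw [SimpleGraph.isTree_iff_connected_and_card, isSubtree_univ_iff]
  refine and_congr_right fun _ => ?_
  simp only [deg_univ]
  rw [SimpleGraph.sum_degrees_eq_twice_card_edges, Nat.card_eq_fintype_card,
    Nat.card_eq_fintype_card, Finset.card_univ, ← SimpleGraph.edgeFinset_card]
  omega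

end

/-! ### Sums over the subtrees of a tree -/

section

open scoped Classical

variable {V : Type*}

theorem GrowsTo.isSubtree {Γ : SimpleGraph V} {I S : Finset V} (h : GrowsTo Γ I S)
    (hI : IsSubtree Γ I) : IsSubtree Γ S := by
  induction h with
  | refl => exact hI
  | step _ hl ih => exact (hl.isSubtree_insert_iff subset_rfl).2 (Or.inr ⟨hl.mem, ih⟩)

/-- The sum of the increments `f j - f i` over the edges leading from `i ∈ I` to `j ∈ C`. -/
noncomputable def crossSum (Γ : SimpleGraph V) (f : V → ℂ) (I C : Finset V) : ℂ :=
  ∑ i ∈ I, ∑ j ∈ C, if Γ.Adj i j then f j - f i else 0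

theorem crossSum_congr {Γ Γ' : SimpleGraph V} {f : V → ℂ} {I C : Finset V}
    (h : ∀ i ∈ I, ∀ j ∈ C, (Γ.Adj i j ↔ Γ'.Adj i j)) :
    crossSum Γ f I C = crossSum Γ' f I C := by
  unfold crossSum
  refine Finset.sum_congr rfl fun i hi => Finset.sum_congr rfl fun j hj => ?_
  simp only [h i hi j hj]

theorem crossSum_swap (Γ : SimpleGraph V) (f : V → ℂ) (I C : Finset V) :
    crossSum Γ f C I = -crossSum Γ f I C := by
  unfold crossSum
  rw [Finset.sum_comm, ← Finset.sum_neg_distrib]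
  refine Finset.sum_congr rfl fun i _ => ?_
  rw [← Finset.sum_neg_distrib]
  refine Finset.sum_congr rfl fun j _ => ?_
  simp only [Γ.adj_comm j i]
  split_ifs <;> ring

theorem crossSum_insert_left (Γ : SimpleGraph V) (f : V → ℂ) {I C : Finset V} {l : V}
    (hl : l ∉ I) : crossSum Γ f (insert l I) C = crossSum Γ f {l} C + crossSum Γ f I C := by
  unfold crossSum
  rw [Finset.sum_insert hl, Finset.sum_singleton]

theorem crossSum_insert_right (Γ : SimpleGraph V) (f : V → ℂ) {I C : Finset V} {l : V}
    (hl : l ∉ C) : crossSum Γ f I (insert l C) = crossSum Γ f I C + crossSum Γ f I {l} := by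
  rw [crossSum_swap, crossSum_insert_left Γ f hl, crossSum_swap Γ f I C, crossSum_swap Γ f I {l}]
  ring

theorem crossSum_eq_zero {Γ : SimpleGraph V} {f : V → ℂ} {I C : Finset V}
    (h : ∀ i ∈ I, ∀ j ∈ C, ¬ Γ.Adj i j) : crossSum Γ f I C = 0 := by
  unfold crossSum
  refine Finset.sum_eq_zero fun i hi => Finset.sum_eq_zero fun j hj => ?_
  rw [if_neg (h i hi j hj)]

theorem IsLeafAt.crossSum_left {Γ : SimpleGraph V} {S C : Finset V} {l m : V}
    (h : IsLeafAt Γ S l m) (hC : C ⊆ S) (f : V → ℂ) :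
    crossSum Γ f {l} C = if m ∈ C then f m - f l else 0 := by
  unfold crossSum
  rw [Finset.sum_singleton]
  have : ∀ j ∈ C, (if Γ.Adj l j then f j - f l else 0) = if m = j then f m - f l else 0 := by
    intro j hj
    rw [h.adj_iff j (hC hj)]
    by_cases hjm : j = m
    · simp [hjm]
    · rw [if_neg hjm, if_neg (Ne.symm hjm)]
  rw [Finset.sum_congr rfl this, Finset.sum_ite_eq]

theorem IsLeafAt.crossSum_right {Γ : SimpleGraph V} {S C : Finset V} {l m : V}
    (h : IsLeafAt Γ S l m) (hC : C ⊆ S) (f : V → ℂ) :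
    crossSum Γ f C {l} = if m ∈ C then f l - f m else 0 := by
  rw [crossSum_swap, h.crossSum_left hC]
  split_ifs <;> ring

/-- Telescoping: cutting an edge of a tree on `S` splits `S` into two subtrees. Only the edges on
the path from `k` to `l` separate `k` from `l`, hence the increments of `f` over
the cut edges add up to `f l - f k`. -/
theorem GrowsTo.sum_crossSum {Γ : SimpleGraph V} {S : Finset V} {v : V} (hS : GrowsTo Γ {v} S)
    (f : V → ℂ) : ∀ k ∈ S, ∀ l ∈ S,
      (∑ I ∈ S.powerset, if k ∈ I ∧ l ∉ I ∧ IsSubtree Γ I ∧ IsSubtree Γ (S \ I) then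
        crossSum Γ f I (S \ I) else 0) = f l - f k := by
  -- `k` and `l` may be exchanged, by passing to the complement
  have symm : ∀ (S : Finset V), ∀ k ∈ S, ∀ l ∈ S,
      (∑ I ∈ S.powerset, if k ∈ I ∧ l ∉ I ∧ IsSubtree Γ I ∧ IsSubtree Γ (S \ I) then
        crossSum Γ f I (S \ I) else 0) =
      -(∑ I ∈ S.powerset, if l ∈ I ∧ k ∉ I ∧ IsSubtree Γ I ∧ IsSubtree Γ (S \ I) then
        crossSum Γ f I (S \ I) else 0) := by
    intro S k hk l hl
    rw [← Finset.sum_neg_distrib]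
    refine Finset.sum_bij' (fun I _ => S \ I) (fun I _ => S \ I) ?_ ?_ ?_ ?_ ?_
    · intro I _; simp
    · intro I _; simp
    · intro I hI; exact Finset.sdiff_sdiff_eq_self (Finset.mem_powerset.1 hI)
    · intro I hI; exact Finset.sdiff_sdiff_eq_self (Finset.mem_powerset.1 hI)
    · intro I hI
      simp only [Finset.sdiff_sdiff_eq_self (Finset.mem_powerset.1 hI), Finset.mem_sdiff, hk, hl,
        true_and, not_not]
      rw [crossSum_swap Γ f I (S \ I), neg_eq_iff_eq_neg.symm]
      by_cases hc : k ∈ I ∧ l ∉ I ∧ IsSubtree Γ I ∧ IsSubtree Γ (S \ I)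
      · rw [if_pos hc, if_pos ⟨hc.2.1, hc.1, hc.2.2.2, hc.2.2.1⟩]
      · rw [if_neg hc, if_neg fun h => hc ⟨h.2.1, h.1, h.2.2.2, h.2.2.1⟩, neg_zero]
  induction hS with
  | refl =>
    intro k hk l hl
    rw [Finset.mem_singleton] at hk hl
    subst hk; subst hl
    rw [sub_self]
    exact Finset.sum_eq_zero fun I _ => if_neg fun h => h.2.1 h.1
  | @step S u m hS hu ih =>
    have hsd : ∀ I ∈ S.powerset, insert u S \ I = insert u (S \ I) := fun I hI =>
      Finset.insert_sdiff_of_notMem _ fun h => hu.notMem (Finset.mem_powerset.1 hI h)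
    have hsd' : ∀ I ∈ S.powerset, insert u S \ insert u I = S \ I := fun I hI => by
      rw [Finset.insert_sdiff_insert, Finset.sdiff_insert_of_notMem hu.notMem]
    have old : ∀ k ∈ S, ∀ l ∈ S, (∑ I ∈ (insert u S).powerset,
        if k ∈ I ∧ l ∉ I ∧ IsSubtree Γ I ∧ IsSubtree Γ (insert u S \ I) then
          crossSum Γ f I (insert u S \ I) else 0) = f l - f k := by
      intro k hk l hl
      rw [← ih k hk l hl, Finset.sum_powerset_insert hu.notMem, ← Finset.sum_add_distrib]
      refine Finset.sum_congr rfl fun I hI => ?_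
      have hIS := Finset.mem_powerset.1 hI
      have huI : u ∉ I := fun h => hu.notMem (hIS h)
      have huk : k ≠ u := fun h => hu.notMem (h ▸ hk)
      have hul : l ≠ u := fun h => hu.notMem (h ▸ hl)
      rw [hsd I hI, hsd' I hI, hu.isSubtree_insert_iff hIS,
        hu.isSubtree_insert_iff Finset.sdiff_subset, crossSum_insert_left Γ f huI,
        crossSum_insert_right Γ f (fun h => hu.notMem (Finset.sdiff_subset h)),
        hu.crossSum_left Finset.sdiff_subset, hu.crossSum_right hIS]
      simp only [Finset.mem_insert, huk, hul, false_or, Finset.mem_sdiff, hu.mem, true_and]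
      by_cases hk' : k ∈ I
      swap
      · simp [hk']
      by_cases hl' : l ∈ I
      · simp [hl']
      have h1 : I ≠ ∅ := fun h => Finset.notMem_empty k (h ▸ hk')
      have h2 : S \ I ≠ ∅ := fun h => Finset.notMem_empty l (h ▸ Finset.mem_sdiff.2 ⟨hl, hl'⟩)
      by_cases hm : m ∈ I <;> simp [hk', hl', h1, h2, hm]
    have new : ∀ l ∈ S, (∑ I ∈ (insert u S).powerset,
        if u ∈ I ∧ l ∉ I ∧ IsSubtree Γ I ∧ IsSubtree Γ (insert u S \ I) then
          crossSum Γ f I (insert u S \ I) else 0) = f l - f u := by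
      intro l hl
      rw [Finset.sum_powerset_insert hu.notMem, Finset.sum_eq_zero, zero_add]
      swap
      · intro I hI
        exact if_neg fun h => hu.notMem (Finset.mem_powerset.1 hI h.1)
      have hul : l ≠ u := fun h => hu.notMem (h ▸ hl)
      have h0 : f l - f u = (∑ I ∈ S.powerset, if ∅ = I then f m - f u else 0) + (f l - f m) := by
        rw [Finset.sum_ite_eq, if_pos (Finset.empty_mem_powerset S)]
        ring
      rw [h0, ← ih m hu.mem l hl, ← Finset.sum_add_distrib]
      refine Finset.sum_congr rfl fun I hI => ?_
      have hIS := Finset.mem_powerset.1 hI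
      have huI : u ∉ I := fun h => hu.notMem (hIS h)
      rw [hsd' I hI, hu.isSubtree_insert_iff hIS, crossSum_insert_left Γ f huI,
        hu.crossSum_left Finset.sdiff_subset]
      rcases eq_or_ne I ∅ with rfl | hne
      · have hSt : IsSubtree Γ S := hS.isSubtree (isSubtree_singleton Γ v)
        simp [hul, hu.mem, hSt, crossSum]
      · simp only [Finset.mem_insert, hul, true_or, false_or, hne, true_and,
          Finset.mem_sdiff, hne.symm, if_false, zero_add, hu.mem]
        by_cases hm : m ∈ I <;> simp [hm]
    intro k hk l hl
    rcases Finset.mem_insert.1 hk with rfl | hk'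
    · rcases Finset.mem_insert.1 hl with rfl | hl'
      · rw [sub_self]
        exact Finset.sum_eq_zero fun I _ => if_neg fun h => h.2.1 h.1
      · exact new l hl'
    · rcases Finset.mem_insert.1 hl with rfl | hl'
      · rw [symm _ k hk l hl, new k hk']
        ring
      · exact old k hk' l hl'

/-- The weight of a subtree on `I` in a tree on `S`: a factor `r v ^ (α - 2)` for every vertex `v`
outside `I`, of valency `α` in `S`, and a factor `r i - r j` for every edge
leading from `i ∈ I` to `j ∉ I`. -/
noncomputable def outerWeight (Γ : SimpleGraph V) (r : V → ℂ) (S I : Finset V) : ℂ :=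
  (∏ v ∈ S \ I, r v ^ deg Γ S v * (r v ^ 2)⁻¹) *
    ∏ i ∈ I, ∏ j ∈ S \ I, if Γ.Adj i j then r i - r j else 1

theorem outerWeight_self (Γ : SimpleGraph V) (r : V → ℂ) (S : Finset V) :
    outerWeight Γ r S S = 1 := by
  simp [outerWeight]

theorem IsLeafAt.deg_self {Γ : SimpleGraph V} {S : Finset V} {l m : V}
    (h : IsLeafAt Γ S l m) : deg Γ (insert l S) l = 1 := by
  rw [deg_insert h.notMem, if_neg Γ.irrefl]
  unfold deg
  have : S.filter (fun j => Γ.Adj l j) = {m} := by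
    ext v
    rw [Finset.mem_filter, Finset.mem_singleton]
    refine ⟨fun hv => (h.adj_iff v hv.1).1 hv.2, ?_⟩
    rintro rfl
    exact ⟨h.mem, (h.adj_iff v h.mem).2 rfl⟩
  rw [this, Finset.card_singleton]

theorem IsLeafAt.deg_eq {Γ : SimpleGraph V} {S : Finset V} {l m v : V}
    (h : IsLeafAt Γ S l m) (hv : v ∈ S) :
    deg Γ (insert l S) v = deg Γ S v + if v = m then 1 else 0 := by
  rw [deg_insert h.notMem, Γ.adj_comm]
  simp only [h.adj_iff v hv]

/-- Outside the subtree, a new leaf `l` at `m` counts `1 / r l`, and it turns into a factor `r m`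
if `m` is outside as well. -/
theorem IsLeafAt.outerWeight_notMem {Γ : SimpleGraph V} {S I : Finset V} {l m : V}
    (h : IsLeafAt Γ S l m) (hI : I ⊆ S) (hm : m ∉ I) (r : V → ℂ) (hr : r l ≠ 0) :
    outerWeight Γ r (insert l S) I = outerWeight Γ r S I * (r m * (r l)⁻¹) := by
  have hlI : l ∉ I := fun h' => h.notMem (hI h')
  have hl : l ∉ S \ I := fun h' => h.notMem (Finset.sdiff_subset h')
  unfold outerWeight
  rw [Finset.insert_sdiff_of_notMem _ hlI, Finset.prod_insert hl, h.deg_self]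
  have h1 : ∏ v ∈ S \ I, r v ^ deg Γ (insert l S) v * (r v ^ 2)⁻¹ =
      (∏ v ∈ S \ I, r v ^ deg Γ S v * (r v ^ 2)⁻¹) * r m := by
    have : ∀ v ∈ S \ I, r v ^ deg Γ (insert l S) v * (r v ^ 2)⁻¹ =
        (r v ^ deg Γ S v * (r v ^ 2)⁻¹) * if m = v then r m else 1 := by
      intro v hv
      rw [h.deg_eq (Finset.sdiff_subset hv)]
      by_cases hvm : v = m
      · subst hvm; simp; ring
      · simp [hvm, Ne.symm hvm]
    rw [Finset.prod_congr rfl this, Finset.prod_mul_distrib, Finset.prod_ite_eq,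
      if_pos (Finset.mem_sdiff.2 ⟨h.mem, hm⟩)]
  have h2 : ∀ i ∈ I, (∏ j ∈ insert l (S \ I), if Γ.Adj i j then r i - r j else 1) =
      ∏ j ∈ S \ I, if Γ.Adj i j then r i - r j else 1 := by
    intro i hi
    rw [Finset.prod_insert hl, Γ.adj_comm, if_neg, one_mul]
    rw [h.adj_iff i (hI hi)]
    rintro rfl
    exact hm hi
  rw [h1, Finset.prod_congr rfl h2]
  field_simp

theorem IsLeafAt.outerWeight_mem {Γ : SimpleGraph V} {S I : Finset V} {l m : V}
    (h : IsLeafAt Γ S l m) (hI : I ⊆ S) (hm : m ∈ I) (r : V → ℂ) (hr : r l ≠ 0) :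
    outerWeight Γ r (insert l S) I = outerWeight Γ r S I * ((r m - r l) * (r l)⁻¹) := by
  have hlI : l ∉ I := fun h' => h.notMem (hI h')
  have hl : l ∉ S \ I := fun h' => h.notMem (Finset.sdiff_subset h')
  unfold outerWeight
  rw [Finset.insert_sdiff_of_notMem _ hlI, Finset.prod_insert hl, h.deg_self]
  have h1 : ∀ v ∈ S \ I, r v ^ deg Γ (insert l S) v * (r v ^ 2)⁻¹ =
      r v ^ deg Γ S v * (r v ^ 2)⁻¹ := by
    intro v hv
    rw [h.deg_eq (Finset.sdiff_subset hv), if_neg, add_zero]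
    rintro rfl
    exact (Finset.mem_sdiff.1 hv).2 hm
  have h2 : ∏ i ∈ I, (∏ j ∈ insert l (S \ I), if Γ.Adj i j then r i - r j else 1) =
      (r m - r l) * ∏ i ∈ I, ∏ j ∈ S \ I, if Γ.Adj i j then r i - r j else 1 := by
    have : ∀ i ∈ I, (∏ j ∈ insert l (S \ I), if Γ.Adj i j then r i - r j else 1) =
        (if m = i then r m - r l else 1) * ∏ j ∈ S \ I, if Γ.Adj i j then r i - r j else 1 := by
      intro i hi
      rw [Finset.prod_insert hl, Γ.adj_comm]
      simp only [h.adj_iff i (hI hi)]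
      by_cases him : i = m
      · simp [him]
      · simp [him, Ne.symm him]
    rw [Finset.prod_congr rfl this, Finset.prod_mul_distrib, Finset.prod_ite_eq, if_pos hm]
  rw [Finset.prod_congr rfl h1, h2]
  field_simp

theorem IsLeafAt.outerWeight_insert {Γ : SimpleGraph V} {S I : Finset V} {l m : V}
    (h : IsLeafAt Γ S l m) (hI : I ⊆ S) (hm : m ∈ I) (r : V → ℂ) :
    outerWeight Γ r (insert l S) (insert l I) = outerWeight Γ r S I := by
  have hlI : l ∉ I := fun h' => h.notMem (hI h')
  unfold outerWeight
  have hsd : insert l S \ insert l I = S \ I := by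
    rw [Finset.insert_sdiff_insert, Finset.sdiff_insert_of_notMem h.notMem]
  rw [hsd, Finset.prod_insert hlI]
  have h1 : ∀ v ∈ S \ I, r v ^ deg Γ (insert l S) v * (r v ^ 2)⁻¹ =
      r v ^ deg Γ S v * (r v ^ 2)⁻¹ := by
    intro v hv
    rw [h.deg_eq (Finset.sdiff_subset hv), if_neg, add_zero]
    rintro rfl
    exact (Finset.mem_sdiff.1 hv).2 hm
  have h2 : ∏ j ∈ S \ I, (if Γ.Adj l j then r l - r j else 1) = 1 := by
    refine Finset.prod_eq_one fun j hj => ?_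
    rw [h.adj_iff j (Finset.sdiff_subset hj), if_neg]
    rintro rfl
    exact (Finset.mem_sdiff.1 hj).2 hm
  rw [Finset.prod_congr rfl h1, h2, one_mul]

/-- The subtrees containing two given vertices `k` and `l`, counted with their weights. Growing
the tree by a leaf `b` at `m`, a subtree that contains `m` can be continued to `b` or not, with
relative weights `r b` and `r m - r b`, and the sum of these does not depend on `b`. -/
theorem GrowsTo.sum_outerWeight {Γ : SimpleGraph V} {S : Finset V} {k : V}
    (hS : GrowsTo Γ {k} S) (r : V → ℂ) (hr : ∀ v, r v ≠ 0) : ∀ l ∈ S,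
      (∑ I ∈ S.powerset, if IsSubtree Γ I ∧ k ∈ I ∧ l ∈ I then outerWeight Γ r S I else 0) =
        r k * r l * outerWeight Γ r S ∅ := by
  induction hS with
  | refl =>
    intro l hl
    rw [Finset.mem_singleton] at hl
    subst hl
    rw [← insert_empty_eq, Finset.sum_powerset_insert (Finset.notMem_empty l),
      Finset.powerset_empty, Finset.sum_singleton, Finset.sum_singleton, insert_empty_eq,
      if_neg (by simp), if_pos (by simp [isSubtree_singleton]), outerWeight_self, zero_add]
    have := hr l
    simp [outerWeight, deg, Finset.filter_singleton]
    field_simp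
  | @step S u m hS hu ih =>
    have hk : k ∈ S := hS.subset (Finset.mem_singleton_self k)
    have huk : k ≠ u := fun h => hu.notMem (h ▸ hk)
    have hru := hr u
    intro l hl
    rw [hu.outerWeight_notMem (Finset.empty_subset S) (Finset.notMem_empty m) r hru,
      Finset.sum_powerset_insert hu.notMem]
    rcases Finset.mem_insert.1 hl with rfl | hl
    · rw [Finset.sum_eq_zero, zero_add]
      swap
      · intro I hI
        exact if_neg fun h => hu.notMem (Finset.mem_powerset.1 hI h.2.2)
      have h0 : r k * r l * (outerWeight Γ r S ∅ * (r m * (r l)⁻¹)) =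
          r k * r m * outerWeight Γ r S ∅ := by field_simp
      rw [h0, ← ih m hu.mem]
      refine Finset.sum_congr rfl fun I hI => ?_
      have hIS := Finset.mem_powerset.1 hI
      rw [hu.isSubtree_insert_iff hIS]
      simp only [Finset.mem_insert, huk, false_or, true_or, and_true]
      by_cases hm : m ∈ I
      · rw [hu.outerWeight_insert hIS hm]
        by_cases hkI : k ∈ I
        · have hne : I ≠ ∅ := fun h => Finset.notMem_empty k (h ▸ hkI)
          simp [hm, hkI, hne]
        · simp [hkI]
      · by_cases hkI : k ∈ I
        · have hne : I ≠ ∅ := fun h => Finset.notMem_empty k (h ▸ hkI)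
          simp [hm, hne]
        · simp [hkI]
    · have hul : l ≠ u := fun h => hu.notMem (h ▸ hl)
      have h0 : r k * r l * (outerWeight Γ r S ∅ * (r m * (r u)⁻¹)) =
          (r k * r l * outerWeight Γ r S ∅) * (r m * (r u)⁻¹) := by ring
      rw [h0, ← ih l hl, Finset.sum_mul, ← Finset.sum_add_distrib]
      refine Finset.sum_congr rfl fun I hI => ?_
      have hIS := Finset.mem_powerset.1 hI
      rw [hu.isSubtree_insert_iff hIS]
      simp only [Finset.mem_insert, huk, hul, false_or]
      by_cases hkI : k ∈ I
      swap
      · simp [hkI]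
      have hne : I ≠ ∅ := fun h => Finset.notMem_empty k (h ▸ hkI)
      by_cases hm : m ∈ I
      · rw [hu.outerWeight_insert hIS hm, hu.outerWeight_mem hIS hm r hru]
        by_cases hc : IsSubtree Γ I ∧ l ∈ I
        · simp only [hc, hkI, hm, hne, false_or, and_self, if_true]
          field_simp
          ring
        · have hc1 : ¬ (IsSubtree Γ I ∧ k ∈ I ∧ l ∈ I) := fun h => hc ⟨h.1, h.2.2⟩
          have hc2 : ¬ ((I = ∅ ∨ m ∈ I ∧ IsSubtree Γ I) ∧ k ∈ I ∧ l ∈ I) := fun h =>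
            hc ⟨(h.1.resolve_left hne).2, h.2.2⟩
          simp [hc1, hc2]
      · rw [hu.outerWeight_notMem hIS hm r hru]
        simp [hm, hne]

/-- The subtrees that arise from `I` by joining a branch containing `k`. The
induction is that of `GrowsTo.sum_outerWeight`. -/
theorem GrowsTo.sum_crossSum_mul_outerWeight {Γ : SimpleGraph V} {I S : Finset V}
    (hS : GrowsTo Γ I S) (r : V → ℂ) (hr : ∀ v, r v ≠ 0) : ∀ k ∈ S \ I,
      (∑ C ∈ (S \ I).powerset, if IsSubtree Γ C ∧ k ∈ C then
        crossSum Γ r I C * outerWeight Γ r S (I ∪ C) else 0) = -(r k * outerWeight Γ r S I) := by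
  induction hS with
  | refl => simp
  | @step S u m hS hu ih =>
    have hIS := hS.subset
    have huI : u ∉ I := fun h => hu.notMem (hIS h)
    have huSI : u ∉ S \ I := fun h => hu.notMem (Finset.sdiff_subset h)
    have hru := hr u
    intro k hk
    rw [Finset.insert_sdiff_of_notMem _ huI] at hk ⊢
    rw [Finset.sum_powerset_insert huSI]
    rcases Finset.mem_insert.1 hk with rfl | hk
    · rw [Finset.sum_eq_zero, zero_add]
      swap
      · intro C hC
        exact if_neg fun h => huSI (Finset.mem_powerset.1 hC h.2)
      by_cases hmI : m ∈ I
      · -- the branch consists of the new leaf only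
        rw [hu.outerWeight_mem hIS hmI r hru, Finset.sum_eq_single ∅]
        · rw [if_pos ⟨(isSubtree_singleton Γ k), by simp⟩, insert_empty_eq,
            hu.crossSum_right hIS, if_pos hmI, Finset.union_comm, ← Finset.insert_eq,
            hu.outerWeight_insert hIS hmI]
          field_simp
          ring
        · intro C hC hne
          have hCS := (Finset.mem_powerset.1 hC).trans Finset.sdiff_subset
          rw [if_neg]
          rw [hu.isSubtree_insert_iff hCS]
          rintro ⟨h1, -⟩
          exact (Finset.mem_sdiff.1 (Finset.mem_powerset.1 hC (h1.resolve_left hne).1)).2 hmI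
        · simp
      · have h0 : -(r k * outerWeight Γ r (insert k S) I) = -(r m * outerWeight Γ r S I) := by
          rw [hu.outerWeight_notMem hIS hmI r hru]
          field_simp
        rw [h0, ← ih m (Finset.mem_sdiff.2 ⟨hu.mem, hmI⟩)]
        refine Finset.sum_congr rfl fun C hC => ?_
        have hCS := (Finset.mem_powerset.1 hC).trans Finset.sdiff_subset
        have hkC : k ∉ C := fun h => hu.notMem (hCS h)
        rw [hu.isSubtree_insert_iff hCS, crossSum_insert_right Γ r hkC, hu.crossSum_right hIS,
          if_neg hmI, add_zero, Finset.union_insert]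
        rcases eq_or_ne C ∅ with rfl | hne
        · simp [crossSum]
        by_cases hmC : m ∈ C
        · rw [hu.outerWeight_insert (Finset.union_subset hIS hCS) (Finset.mem_union_right _ hmC)]
          simp [hmC, hne]
        · simp [hmC, hne]
    · have huk : k ≠ u := fun h => huSI (h ▸ hk)
      have h0 : ∃ c, outerWeight Γ r (insert u S) I = outerWeight Γ r S I * c ∧
          (m ∈ I → c = (r m - r u) * (r u)⁻¹) ∧ (m ∉ I → c = r m * (r u)⁻¹) := by
        by_cases hmI : m ∈ I
        · exact ⟨_, hu.outerWeight_mem hIS hmI r hru, fun _ => rfl, fun h => absurd hmI h⟩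
        · exact ⟨_, hu.outerWeight_notMem hIS hmI r hru, fun h => absurd h hmI, fun _ => rfl⟩
      obtain ⟨c, hc, hc1, hc2⟩ := h0
      rw [hc, ← mul_assoc, ← neg_mul, ← ih k hk, Finset.sum_mul, ← Finset.sum_add_distrib]
      refine Finset.sum_congr rfl fun C hC => ?_
      have hCS := (Finset.mem_powerset.1 hC).trans Finset.sdiff_subset
      have huC : u ∉ C := fun h => hu.notMem (hCS h)
      rw [hu.isSubtree_insert_iff hCS, crossSum_insert_right Γ r huC, hu.crossSum_right hIS,
        Finset.union_insert]
      simp only [Finset.mem_insert, huk, false_or]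
      by_cases hkC : k ∈ C
      swap
      · simp [hkC]
      have hne : C ≠ ∅ := fun h => Finset.notMem_empty k (h ▸ hkC)
      by_cases hmC : m ∈ C
      · have hmI : m ∉ I := (Finset.mem_sdiff.1 (Finset.mem_powerset.1 hC hmC)).2
        have hmU : m ∈ I ∪ C := Finset.mem_union_right _ hmC
        have hU := Finset.union_subset hIS hCS
        rw [hu.outerWeight_insert hU hmU, hu.outerWeight_mem hU hmU r hru, hc2 hmI]
        by_cases hcon : IsSubtree Γ C
        · simp only [hcon, hkC, hne, hmC, hmI, and_self, or_true, if_true, if_false, add_zero]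
          field_simp
          ring
        · simp [hcon, hne]
      · have hU := Finset.union_subset hIS hCS
        by_cases hmI : m ∈ I
        · rw [hu.outerWeight_mem hU (Finset.mem_union_left _ hmI) r hru, hc1 hmI]
          simp [hmC, hne, mul_assoc]
        · rw [hu.outerWeight_notMem hU (by simp [hmI, hmC]) r hru, hc2 hmI]
          simp [hmC, hne, mul_assoc]

end

/-! ### Cutting a spanning tree at an edge -/

section

open scoped Classical

variable {V : Type*}

/-- The graph on `V` that has the edges of `Γ` inside `S` only. -/
def restrictTo (Γ : SimpleGraph V) (S : Finset V) : SimpleGraph V where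
  Adj a b := Γ.Adj a b ∧ a ∈ S ∧ b ∈ S
  symm := ⟨fun _ _ h => ⟨h.1.symm, h.2.2, h.2.1⟩⟩
  loopless := ⟨fun _ h => Γ.irrefl h.1⟩

/-- The union of two graphs, joined by the edge from `i` to `j`. -/
def joinAt (Γ₁ Γ₂ : SimpleGraph V) (i j : V) : SimpleGraph V := Γ₁ ⊔ Γ₂ ⊔ SimpleGraph.edge i j

theorem joinAt_adj {Γ₁ Γ₂ : SimpleGraph V} {i j a b : V} : (joinAt Γ₁ Γ₂ i j).Adj a b ↔
    (Γ₁.Adj a b ∨ Γ₂.Adj a b) ∨ ((i = a ∧ j = b ∨ i = b ∧ j = a) ∧ a ≠ b) := by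
  unfold joinAt
  rw [SimpleGraph.sup_adj, SimpleGraph.sup_adj, SimpleGraph.edge_adj]
  tauto

theorem joinAt_comm (Γ₁ Γ₂ : SimpleGraph V) (i j : V) :
    joinAt Γ₁ Γ₂ i j = joinAt Γ₂ Γ₁ j i := by
  ext a b
  rw [joinAt_adj, joinAt_adj]
  tauto

/-- All the edges of `Γ` are inside `S`. -/
def SupportedOn (Γ : SimpleGraph V) (S : Finset V) : Prop := ∀ a b, Γ.Adj a b → a ∈ S

section Join

variable {Γ₁ Γ₂ : SimpleGraph V} {I C : Finset V} {i j : V}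

theorem joinAt_adj_left (h : Disjoint I C) (h₂ : SupportedOn Γ₂ C) (hj : j ∈ C) :
    ∀ a ∈ I, ∀ b ∈ I, ((joinAt Γ₁ Γ₂ i j).Adj a b ↔ Γ₁.Adj a b) := by
  intro a ha b hb
  rw [joinAt_adj]
  have hd : ∀ c ∈ I, c ∉ C := fun c hc => Finset.disjoint_left.1 h hc
  constructor
  · rintro ((h | h) | ⟨(⟨rfl, rfl⟩ | ⟨rfl, rfl⟩), -⟩)
    · exact h
    · exact absurd (h₂ _ _ h) (hd a ha)
    · exact absurd hj (hd _ hb)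
    · exact absurd hj (hd _ ha)
  · exact fun h => Or.inl (Or.inl h)

theorem joinAt_adj_right (h : Disjoint I C) (h₁ : SupportedOn Γ₁ I) (hi : i ∈ I) :
    ∀ a ∈ C, ∀ b ∈ C, ((joinAt Γ₁ Γ₂ i j).Adj a b ↔ Γ₂.Adj a b) := by
  intro a ha b hb
  rw [joinAt_adj]
  have hd : ∀ c ∈ C, c ∉ I := fun c hc => Finset.disjoint_right.1 h hc
  constructor
  · rintro ((h | h) | ⟨(⟨rfl, rfl⟩ | ⟨rfl, rfl⟩), -⟩)
    · exact absurd (h₁ _ _ h) (hd a ha)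
    · exact h
    · exact absurd hi (hd _ ha)
    · exact absurd hi (hd _ hb)
  · exact fun h => Or.inl (Or.inr h)

theorem joinAt_adj_cross (h : Disjoint I C) (h₁ : SupportedOn Γ₁ I) (h₂ : SupportedOn Γ₂ C)
    (hi : i ∈ I) : ∀ a ∈ I, ∀ b ∈ C, ((joinAt Γ₁ Γ₂ i j).Adj a b ↔ a = i ∧ b = j) := by
  intro a ha b hb
  rw [joinAt_adj]
  have hab : a ≠ b := by rintro rfl; exact Finset.disjoint_left.1 h ha hb
  constructor
  · rintro ((h' | h') | ⟨(⟨rfl, rfl⟩ | ⟨rfl, rfl⟩), -⟩)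
    · exact absurd hb (Finset.disjoint_left.1 h (h₁ _ _ h'.symm))
    · exact absurd (h₂ _ _ h') (Finset.disjoint_left.1 h ha)
    · exact ⟨rfl, rfl⟩
    · exact absurd hb (Finset.disjoint_left.1 h hi)
  · rintro ⟨rfl, rfl⟩
    exact Or.inr ⟨Or.inl ⟨rfl, rfl⟩, hab⟩

theorem deg_joinAt (h : Disjoint I C) (h₁ : SupportedOn Γ₁ I) (h₂ : SupportedOn Γ₂ C)
    (hi : i ∈ I) (hj : j ∈ C) :
    ∀ v ∈ I, deg (joinAt Γ₁ Γ₂ i j) C v = if i = v then 1 else 0 := by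
  have hx := joinAt_adj_cross (j := j) h h₁ h₂ hi
  intro v hv
  unfold deg
  split_ifs with hvi
  · subst hvi
    rw [Finset.card_eq_one]
    refine ⟨j, ?_⟩
    ext b
    rw [Finset.mem_filter, Finset.mem_singleton]
    refine ⟨fun hb => ((hx i hv b hb.1).1 hb.2).2, ?_⟩
    rintro rfl
    exact ⟨hj, (hx i hv b hj).2 ⟨rfl, rfl⟩⟩
  · rw [Finset.card_eq_zero, Finset.filter_eq_empty_iff]
    exact fun b hb hab => hvi ((hx v hv b hb).1 hab).1.symm

theorem isTreeOn_joinAt (h : Disjoint I C) (h₁ : SupportedOn Γ₁ I) (h₂ : SupportedOn Γ₂ C)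
    (hi : i ∈ I) (hj : j ∈ C) (t₁ : IsTreeOn Γ₁ I) (t₂ : IsTreeOn Γ₂ C) :
    IsTreeOn (joinAt Γ₁ Γ₂ i j) (I ∪ C) := by
  have t₁' := (IsTreeOn.congr (joinAt_adj_left (Γ₁ := Γ₁) (i := i) h h₂ hj)).2 t₁
  have t₂' := (IsTreeOn.congr (joinAt_adj_right (Γ₂ := Γ₂) (j := j) h h₁ hi)).2 t₂
  have hx := joinAt_adj_cross (j := j) h h₁ h₂ hi
  refine ⟨t₁'.1.union t₂'.1 hi hj ((hx i hi j hj).2 ⟨rfl, rfl⟩), ?_⟩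
  rw [sum_deg_union h, Finset.sum_congr rfl (deg_joinAt h h₁ h₂ hi hj), Finset.sum_ite_eq, if_pos hi,
    Finset.card_union_of_disjoint h]
  have := t₁'.2
  have := t₂'.2
  omega

end Join

theorem restrictTo_adj (Γ : SimpleGraph V) (S : Finset V) :
    ∀ a ∈ S, ∀ b ∈ S, ((restrictTo Γ S).Adj a b ↔ Γ.Adj a b) :=
  fun _ ha _ hb => ⟨fun h => h.1, fun h => ⟨h, ha, hb⟩⟩

/-- If a tree on `I ∪ C` is connected on `I` and on `C`, there is exactly one edge between
these. -/
theorem IsTreeOn.exists_eq_joinAt {Γ : SimpleGraph V} {I C : Finset V} (h : Disjoint I C)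
    (hs : SupportedOn Γ (I ∪ C)) (ht : IsTreeOn Γ (I ∪ C)) (hI : IsSubtree Γ I)
    (hC : IsSubtree Γ C) :
    ∃ i ∈ I, ∃ j ∈ C, Γ = joinAt (restrictTo Γ I) (restrictTo Γ C) i j := by
  obtain ⟨i, hi, j, hj, hjI, hij⟩ := ((isSubtree_iff _ _).1 ht.1).2 I Finset.subset_union_left
    hI.nonempty (by
      obtain ⟨c, hc⟩ := hC.nonempty
      intro h'
      exact Finset.disjoint_right.1 h hc (h' ▸ Finset.mem_union_right _ hc))
  replace hj := (Finset.mem_union.1 hj).resolve_left hjI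
  have hone : ((I ×ˢ C).filter (fun e => Γ.Adj e.1 e.2)).card = 1 := by
    have h1 : ((I ×ˢ C).filter (fun e => Γ.Adj e.1 e.2)).card = ∑ v ∈ I, deg Γ C v := by
      unfold deg
      simp only [Finset.card_filter]
      rw [Finset.sum_product]
    rw [h1]
    have t1 := (ht.of_subset hI Finset.subset_union_left).2
    have t2 := (ht.of_subset hC Finset.subset_union_right).2
    have t3 := ht.2
    rw [sum_deg_union h, Finset.card_union_of_disjoint h] at t3
    omega
  have huniq : ∀ a ∈ I, ∀ b ∈ C, Γ.Adj a b → a = i ∧ b = j := by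
    intro a ha b hb hab
    have := Finset.card_le_one.1 hone.le (a, b) (by simp [ha, hb, hab]) (i, j)
      (by simp [hi, hj, hij])
    exact Prod.ext_iff.1 this
  refine ⟨i, hi, j, hj, ?_⟩
  ext a b
  rw [joinAt_adj]
  constructor
  · intro hab
    rcases Finset.mem_union.1 (hs _ _ hab) with ha | ha <;>
      rcases Finset.mem_union.1 (hs _ _ hab.symm) with hb | hb
    · exact Or.inl (Or.inl ⟨hab, ha, hb⟩)
    · obtain ⟨rfl, rfl⟩ := huniq a ha b hb hab
      exact Or.inr ⟨Or.inl ⟨rfl, rfl⟩, hab.ne⟩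
    · obtain ⟨rfl, rfl⟩ := huniq b hb a ha hab.symm
      exact Or.inr ⟨Or.inr ⟨rfl, rfl⟩, hab.ne⟩
    · exact Or.inl (Or.inr ⟨hab, ha, hb⟩)
  · rintro ((h | h) | ⟨(⟨rfl, rfl⟩ | ⟨rfl, rfl⟩), -⟩)
    · exact h.1
    · exact h.1
    · exact hij
    · exact hij.symm

variable [Fintype V]

/-- The trees with vertex set `S`, as graphs on `V` without edges outside `S`. -/
noncomputable def treesOn (S : Finset V) : Finset (SimpleGraph V) :=
  Finset.univ.filter (fun Γ => SupportedOn Γ S ∧ IsTreeOn Γ S)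

theorem mem_treesOn {S : Finset V} {Γ : SimpleGraph V} :
    Γ ∈ treesOn S ↔ SupportedOn Γ S ∧ IsTreeOn Γ S := by
  simp [treesOn]

theorem treesOn_univ : treesOn (Finset.univ : Finset V) = spanningTrees V := by
  ext Γ
  rw [mem_treesOn, isTreeOn_univ_iff]
  simp [spanningTrees, SupportedOn]

/-- The trees on `I ∪ C` that are connected on both parts are the pairs of
a tree on `I` and a tree on `C`, joined by an edge. -/
theorem sum_treesOn_union {I C : Finset V} (h : Disjoint I C) (g : SimpleGraph V → ℂ) :
    (∑ Γ ∈ treesOn (I ∪ C), if IsSubtree Γ I ∧ IsSubtree Γ C then g Γ else 0) =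
      ∑ Γ₁ ∈ treesOn I, ∑ Γ₂ ∈ treesOn C, ∑ i ∈ I, ∑ j ∈ C, g (joinAt Γ₁ Γ₂ i j) := by
  rw [← Finset.sum_filter]
  simp only [← Finset.sum_product']
  symm
  refine Finset.sum_nbij (fun t => joinAt t.1 t.2.1 t.2.2.1 t.2.2.2) ?_ ?_ ?_ ?_
  · rintro ⟨Γ₁, Γ₂, i, j⟩ ht
    simp only [Finset.mem_product, mem_treesOn] at ht
    obtain ⟨⟨s₁, t₁⟩, ⟨s₂, t₂⟩, hi, hj⟩ := ht
    rw [Finset.mem_filter, mem_treesOn]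
    refine ⟨⟨?_, isTreeOn_joinAt h s₁ s₂ hi hj t₁ t₂⟩,
      (IsSubtree.congr (joinAt_adj_left h s₂ hj)).2 t₁.1,
      (IsSubtree.congr (joinAt_adj_right h s₁ hi)).2 t₂.1⟩
    intro a b hab
    rw [joinAt_adj] at hab
    rcases hab with ((h' | h') | ⟨(⟨rfl, rfl⟩ | ⟨rfl, rfl⟩), -⟩)
    · exact Finset.mem_union_left _ (s₁ _ _ h')
    · exact Finset.mem_union_right _ (s₂ _ _ h')
    · exact Finset.mem_union_left _ hi
    · exact Finset.mem_union_right _ hj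
  · rintro ⟨Γ₁, Γ₂, i, j⟩ ht ⟨Γ₁', Γ₂', i', j'⟩ ht' heq
    simp only [Finset.coe_product, Set.mem_prod, Finset.mem_coe, mem_treesOn] at ht ht'
    obtain ⟨⟨s₁, t₁⟩, ⟨s₂, t₂⟩, hi, hj⟩ := ht
    obtain ⟨⟨s₁', t₁'⟩, ⟨s₂', t₂'⟩, hi', hj'⟩ := ht'
    simp only at heq hi hj hi' hj'
    have e1 : Γ₁ = Γ₁' := by
      ext a b
      by_cases hab : a ∈ I ∧ b ∈ I
      · rw [← joinAt_adj_left (i := i) h s₂ hj a hab.1 b hab.2, heq,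
          joinAt_adj_left h s₂' hj' a hab.1 b hab.2]
      · exact ⟨fun h => absurd ⟨s₁ _ _ h, s₁ _ _ h.symm⟩ hab,
          fun h => absurd ⟨s₁' _ _ h, s₁' _ _ h.symm⟩ hab⟩
    have e2 : Γ₂ = Γ₂' := by
      ext a b
      by_cases hab : a ∈ C ∧ b ∈ C
      · rw [← joinAt_adj_right (j := j) h s₁ hi a hab.1 b hab.2, heq,
          joinAt_adj_right h s₁' hi' a hab.1 b hab.2]
      · exact ⟨fun h => absurd ⟨s₂ _ _ h, s₂ _ _ h.symm⟩ hab,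
          fun h => absurd ⟨s₂' _ _ h, s₂' _ _ h.symm⟩ hab⟩
    have e3 : i = i' ∧ j = j' := by
      rw [← joinAt_adj_cross h s₁' s₂' hi' i hi j hj, ← heq,
        joinAt_adj_cross h s₁ s₂ hi i hi j hj]
      exact ⟨rfl, rfl⟩
    rw [e1, e2, e3.1, e3.2]
  · intro Γ hΓ
    rw [Finset.coe_filter, Set.mem_ofPred_eq, mem_treesOn] at hΓ
    obtain ⟨⟨hs, ht⟩, hI, hC⟩ := hΓ
    obtain ⟨i, hi, j, hj, heq⟩ := ht.exists_eq_joinAt h hs hI hC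
    refine ⟨(restrictTo Γ I, restrictTo Γ C, i, j), ?_, heq.symm⟩
    simp only [Finset.coe_product, Set.mem_prod, Finset.mem_coe, mem_treesOn]
    refine ⟨⟨fun a b hab => hab.2.1, ?_⟩, ⟨fun a b hab => hab.2.1, ?_⟩, hi, hj⟩
    · exact (IsTreeOn.congr (restrictTo_adj Γ I)).2 (ht.of_subset hI Finset.subset_union_left)
    · exact (IsTreeOn.congr (restrictTo_adj Γ C)).2 (ht.of_subset hC Finset.subset_union_right)
  · intro t _
    rfl

theorem edgeFinset_joinAt {Γ₁ Γ₂ : SimpleGraph V} {I C : Finset V} {i j : V}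
    (h : Disjoint I C) (h₁ : SupportedOn Γ₁ I) (h₂ : SupportedOn Γ₂ C) (hi : i ∈ I)
    (hj : j ∈ C) (w : Sym2 V → ℂ) : ∏ e ∈ (joinAt Γ₁ Γ₂ i j).edgeFinset, w e =
      (∏ e ∈ Γ₁.edgeFinset, w e) * (∏ e ∈ Γ₂.edgeFinset, w e) * w s(i, j) := by
  have hd : ∀ a ∈ I, a ∉ C := fun a ha => Finset.disjoint_left.1 h ha
  have hne : i ≠ j := by rintro rfl; exact hd i hi hj
  have e1 : (joinAt Γ₁ Γ₂ i j).edgeFinset =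
      (Γ₁.edgeFinset ∪ Γ₂.edgeFinset) ∪ {s(i, j)} := by
    ext e
    induction e with
    | _ a b =>
      simp only [SimpleGraph.mem_edgeFinset, SimpleGraph.mem_edgeSet, Finset.mem_union,
        Finset.mem_singleton, joinAt_adj, Sym2.eq_iff]
      constructor
      · rintro (h | ⟨(⟨rfl, rfl⟩ | ⟨rfl, rfl⟩), -⟩)
        · exact Or.inl h
        · exact Or.inr (Or.inl ⟨rfl, rfl⟩)
        · exact Or.inr (Or.inr ⟨rfl, rfl⟩)
      · rintro (h | ⟨rfl, rfl⟩ | ⟨rfl, rfl⟩)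
        · exact Or.inl h
        · exact Or.inr ⟨Or.inl ⟨rfl, rfl⟩, hne⟩
        · exact Or.inr ⟨Or.inr ⟨rfl, rfl⟩, hne.symm⟩
  have d1 : Disjoint Γ₁.edgeFinset Γ₂.edgeFinset := by
    rw [Finset.disjoint_left]
    intro e
    induction e with
    | _ a b =>
      simp only [SimpleGraph.mem_edgeFinset, SimpleGraph.mem_edgeSet]
      exact fun ha hb => hd a (h₁ _ _ ha) (h₂ _ _ hb)
  have d2 : Disjoint (Γ₁.edgeFinset ∪ Γ₂.edgeFinset) {s(i, j)} := by
    rw [Finset.disjoint_singleton_right]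
    simp only [Finset.mem_union, SimpleGraph.mem_edgeFinset, SimpleGraph.mem_edgeSet]
    rintro (ha | ha)
    · exact hd j (h₁ _ _ ha.symm) hj
    · exact hd i hi (h₂ _ _ ha)
  rw [e1, Finset.prod_union d2, Finset.prod_union d1, Finset.prod_singleton]

end

/-! ### Spinor algebra -/

theorem bracket_swap (a b : Spinor) : bracket a b = -bracket b a := by
  simp only [bracket]; ring

theorem bracket_self (a : Spinor) : bracket a a = 0 := by
  simp only [bracket]; ring

/-- The Schouten identity. -/
theorem schouten (a b c d : Spinor) :
    bracket a b * bracket c d = bracket a c * bracket b d - bracket a d * bracket b c := by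
  simp only [bracket]; ring

theorem sqr_eq (P : Momentum) : sqr P = P 0 0 * P 1 1 - P 0 1 * P 1 0 := by
  simp [sqr, raise, Fin.sum_univ_two]; ring

theorem sqr_nullMom (l m : Spinor) : sqr (nullMom l m) = 0 := by
  simp [sqr_eq, nullMom, Matrix.vecMulVec_apply]; ring

theorem sqr_neg (P : Momentum) : sqr (-P) = sqr P := by
  simp [sqr_eq]

theorem sqr_nullMom_add_nullMom (a a' b b' : Spinor) :
    sqr (nullMom a a' + nullMom b b') = bracket a b * bracket a' b' := by
  simp [sqr_eq, nullMom, Matrix.vecMulVec_apply, bracket]; ring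

theorem sandwich₁_add (l : Spinor) (P Q : Momentum) (m : Spinor) :
    sandwich₁ l (P + Q) m = sandwich₁ l P m + sandwich₁ l Q m := by
  simp [sandwich₁, slashLeft, bracket]; ring

theorem sandwich₁_neg (l : Spinor) (P : Momentum) (m : Spinor) :
    sandwich₁ l (-P) m = -sandwich₁ l P m := by
  simp [sandwich₁, slashLeft, bracket]; ring

theorem sandwich₁_nullMom (l a a' m : Spinor) :
    sandwich₁ l (nullMom a a') m = bracket l a * bracket a' m := by
  simp [sandwich₁, slashLeft, bracket, nullMom, Matrix.vecMulVec_apply]; ring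

theorem sandwich₂_add_left (l : Spinor) (P P' Q : Momentum) (m : Spinor) :
    sandwich₂ l (P + P') Q m = sandwich₂ l P Q m + sandwich₂ l P' Q m := by
  simp [sandwich₂, slashLeft, slashRight, bracket]; ring

theorem sandwich₂_add_right (l : Spinor) (P Q Q' : Momentum) (m : Spinor) :
    sandwich₂ l P (Q + Q') m = sandwich₂ l P Q m + sandwich₂ l P Q' m := by
  simp [sandwich₂, slashLeft, slashRight, bracket]; ring

theorem sandwich₂_neg_left (l : Spinor) (P Q : Momentum) (m : Spinor) :
    sandwich₂ l (-P) Q m = -sandwich₂ l P Q m := by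
  simp [sandwich₂, slashLeft, slashRight, bracket]; ring

theorem sandwich₂_neg_right (l : Spinor) (P Q : Momentum) (m : Spinor) :
    sandwich₂ l P (-Q) m = -sandwich₂ l P Q m := by
  simp [sandwich₂, slashLeft, slashRight, bracket]; ring

theorem sandwich₂_nullMom_left (l a a' : Spinor) (Q : Momentum) (m : Spinor) :
    sandwich₂ l (nullMom a a') Q m = bracket l a * bracket a' (slashRight Q m) := by
  simp [sandwich₂, slashLeft, bracket, nullMom, Matrix.vecMulVec_apply]; ring

theorem sandwich₂_nullMom_right (l : Spinor) (P : Momentum) (b b' m : Spinor) :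
    sandwich₂ l P (nullMom b b') m = bracket (slashLeft l P) b' * bracket b m := by
  simp [sandwich₂, slashRight, bracket, nullMom, Matrix.vecMulVec_apply]; ring

theorem sandwich₂_nullMom (l a a' b b' m : Spinor) :
    sandwich₂ l (nullMom a a') (nullMom b b') m = bracket l a * bracket a' b' * bracket b m := by
  simp [sandwich₂, slashLeft, slashRight, bracket, nullMom, Matrix.vecMulVec_apply]; ring

/-- `P` squares to a multiple of the identity. -/
theorem sandwich₂_self (l : Spinor) (P : Momentum) (m : Spinor) :
    sandwich₂ l P P m = -(sqr P * bracket l m) := by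
  simp [sandwich₂, slashLeft, slashRight, bracket, sqr_eq]; ring

section

variable {V : Type*} (x : Kinematics V)

theorem sandwich₁_mom (l m : Spinor) (S : Finset V) :
    sandwich₁ l (mom x S) m = ∑ k ∈ S, bracket l (ang x k) * bracket (squ x k) m := by
  simp only [← sandwich₁_nullMom]
  exact map_sum (AddMonoidHom.mk' (fun P => sandwich₁ l P m)
    (fun P Q => sandwich₁_add l P Q m)) _ _

theorem sandwich₂_mom_right (l m : Spinor) (P : Momentum) (S : Finset V) :
    sandwich₂ l P (mom x S) m =
      ∑ k ∈ S, bracket (slashLeft l P) (squ x k) * bracket (ang x k) m := by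
  simp only [← sandwich₂_nullMom_right]
  exact map_sum (AddMonoidHom.mk' (fun Q => sandwich₂ l P Q m)
    (fun Q Q' => sandwich₂_add_right l P Q Q' m)) _ _

theorem sandwich₂_mom_left (l m : Spinor) (Q : Momentum) (S : Finset V) :
    sandwich₂ l (mom x S) Q m =
      ∑ k ∈ S, bracket l (ang x k) * bracket (squ x k) (slashRight Q m) := by
  simp only [← sandwich₂_nullMom_left]
  exact map_sum (AddMonoidHom.mk' (fun P => sandwich₂ l P Q m)
    (fun P P' => sandwich₂_add_left l P P' Q m)) _ _

theorem sandwich₂_mom_mom (l m : Spinor) (I C : Finset V) :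
    sandwich₂ l (mom x I) (mom x C) m = ∑ i ∈ I, ∑ j ∈ C,
      bracket l (ang x i) * bracket (squ x i) (squ x j) * bracket (ang x j) m := by
  simp only [← sandwich₂_nullMom]
  refine (map_sum (AddMonoidHom.mk' (fun P => sandwich₂ l P (mom x C) m)
    (fun P P' => sandwich₂_add_left l P P' (mom x C) m)) _ _).trans ?_
  refine Finset.sum_congr rfl fun i _ => ?_
  exact map_sum (AddMonoidHom.mk' (fun Q => sandwich₂ l (nullMom (ang x i) (squ x i)) Q m)
    (fun Q Q' => sandwich₂_add_right l _ Q Q' m)) _ _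

theorem mom_apply (S : Finset V) (A A' : Fin 2) :
    mom x S A A' = ∑ i ∈ S, ang x i A * squ x i A' := by
  simp [mom, nullMom, Matrix.sum_apply, Matrix.vecMulVec_apply]

theorem sqr_mom (S : Finset V) : sqr (mom x S) =
    (1 / 2) * ∑ k ∈ S, ∑ l ∈ S,
      bracket (ang x k) (ang x l) * bracket (squ x k) (squ x l) := by
  have h : ∀ k l, bracket (ang x k) (ang x l) * bracket (squ x k) (squ x l) =
      (ang x k 0 * squ x k 0) * (ang x l 1 * squ x l 1)
        + (ang x k 1 * squ x k 1) * (ang x l 0 * squ x l 0)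
        - (ang x k 0 * squ x k 1) * (ang x l 1 * squ x l 0)
        - (ang x k 1 * squ x k 0) * (ang x l 0 * squ x l 1) := by
    intro k l; simp only [bracket]; ring
  simp only [h, Finset.sum_add_distrib, Finset.sum_sub_distrib, ← Finset.mul_sum,
    ← Finset.sum_mul, sqr_eq, mom_apply]
  ring

theorem mom_singleton (i : V) : mom x {i} = nullMom (ang x i) (squ x i) := by
  simp [mom]

theorem sqr_mom₁_singleton (i : V) : sqr (mom₁ x {i}) =
    bracket (one x) (ang x i) * bracket (oneT x) (squ x i) := by
  rw [mom₁, mom_singleton, sqr_nullMom_add_nullMom]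

end

/-! ### The currents as sums over trees -/

section

open scoped Classical

variable {V : Type*} (x : Kinematics V)

theorem mom_union {I C : Finset V} (h : Disjoint I C) : mom x (I ∪ C) = mom x I + mom x C :=
  Finset.sum_union h

theorem mem_ssubsets_erase {S I : Finset V} : I ∈ S.ssubsets.erase ∅ ↔
    I ⊆ S ∧ I.Nonempty ∧ (S \ I).Nonempty := by
  rw [Finset.mem_erase, Finset.mem_ssubsets, ← Finset.nonempty_iff_ne_empty,
    Finset.ssubset_iff_subset_ne, Finset.sdiff_nonempty]
  constructor
  · rintro ⟨h1, h2, h3⟩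
    exact ⟨h2, h1, fun h => h3 (Finset.Subset.antisymm h2 h)⟩
  · rintro ⟨h1, h2, h3⟩
    exact ⟨h2, h1, by rintro rfl; exact h3 subset_rfl⟩

theorem plusCurrent_singleton (i : V) :
    plusCurrent x {i} = (bracket (one x) (ang x i) ^ 4)⁻¹ := by
  rw [plusCurrent]; simp

theorem plusCurrent_of_card_ne_one {S : Finset V} (hS : S.card ≠ 1) :
    plusCurrent x S = (sqr (mom x S))⁻¹ * ((1 / 2) * ∑ I ∈ S.ssubsets.erase ∅,
      sandwich₂ (one x) (mom x I) (mom x (S \ I)) (one x) ^ 2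
        * plusCurrent x I * plusCurrent x (S \ I)) := by
  rw [plusCurrent, if_neg hS]
  congr 2
  exact Finset.sum_attach (S.ssubsets.erase ∅) (fun I =>
    sandwich₂ (one x) (mom x I) (mom x (S \ I)) (one x) ^ 2
        * plusCurrent x I * plusCurrent x (S \ I))

/-- The source `(q|S|p]^2/[1p]^2` of the all-but-one-plus current. -/
noncomputable def minusSource (p : Spinor) (S : Finset V) : ℂ :=
  sandwich₁ (one x) (mom x S) p ^ 2 / bracket (oneT x) p ^ 2

/-- The amputated all-but-one-plus current `(1+S)^2 J(1|S)`, as given by the recursion. -/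
noncomputable def oneMinusNumerator (p : Spinor) (S : Finset V) : ℂ :=
  minusSource x p S * plusCurrent x S + ∑ I ∈ S.ssubsets.erase ∅,
    sandwich₂ (one x) (mom x I) (mom x (S \ I)) (one x) ^ 2
      * oneMinusCurrent x p I * plusCurrent x (S \ I)

theorem oneMinusCurrent_eq (p : Spinor) (S : Finset V) :
    oneMinusCurrent x p S = (sqr (mom₁ x S))⁻¹ * oneMinusNumerator x p S := by
  rw [oneMinusCurrent, oneMinusNumerator]
  congr 2
  exact Finset.sum_attach (S.ssubsets.erase ∅) (fun I =>
    sandwich₂ (one x) (mom x I) (mom x (S \ I)) (one x) ^ 2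
        * oneMinusCurrent x p I * plusCurrent x (S \ I))

/-- The factor by which a tree that is cut into subtrees on `I` and on `C` contributes to the
recursion of the currents. Here `f` is a potential with `(ij) / ((q i)(q j)) = f j - f i`. -/
noncomputable def splitFactor (f : V → ℂ) (Γ : SimpleGraph V) (I C : Finset V) : ℂ :=
  -(crossSum Γ f I C * sandwich₂ (one x) (mom x I) (mom x C) (one x))

/-- The contribution of a single tree `Γ` on `S` to the all-but-one-plus current `J(1|S)`, apart
from the factor `J(Γ)`. It satisfies the recursion in which `S` is split into two
subtrees of `Γ`. -/
noncomputable def treeCurrent (p : Spinor) (f : V → ℂ) (Γ : SimpleGraph V) (S : Finset V) : ℂ :=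
  (sqr (mom₁ x S))⁻¹ * (minusSource x p S + ∑ I ∈ (S.ssubsets.erase ∅).attach,
    if IsSubtree Γ I.1 ∧ IsSubtree Γ (S \ I.1) then
      splitFactor x f Γ I.1 (S \ I.1) * treeCurrent p f Γ I.1 else 0)
termination_by S.card
decreasing_by
  exact Finset.card_lt_card (Finset.mem_ssubsets.1 (Finset.mem_erase.1 I.2).2)

/-- The amputated current of a single tree. -/
noncomputable def treeNumerator (p : Spinor) (f : V → ℂ) (Γ : SimpleGraph V) (S : Finset V) : ℂ :=
  minusSource x p S + ∑ I ∈ S.ssubsets.erase ∅,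
    if IsSubtree Γ I ∧ IsSubtree Γ (S \ I) then
      splitFactor x f Γ I (S \ I) * treeCurrent x p f Γ I else 0

theorem treeCurrent_eq (p : Spinor) (f : V → ℂ) (Γ : SimpleGraph V) (S : Finset V) :
    treeCurrent x p f Γ S = (sqr (mom₁ x S))⁻¹ * treeNumerator x p f Γ S := by
  rw [treeCurrent, treeNumerator]
  congr 2
  exact Finset.sum_attach (S.ssubsets.erase ∅) (fun I =>
    if IsSubtree Γ I ∧ IsSubtree Γ (S \ I) then
      splitFactor x f Γ I (S \ I) * treeCurrent x p f Γ I else 0)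

theorem treeCurrent_congr (p : Spinor) (f : V → ℂ) (Γ Γ' : SimpleGraph V) (S : Finset V) :
    (∀ i ∈ S, ∀ j ∈ S, (Γ.Adj i j ↔ Γ'.Adj i j)) →
      treeCurrent x p f Γ S = treeCurrent x p f Γ' S := by
  induction S using Finset.strongInduction with
  | H S ih =>
    intro h
    rw [treeCurrent_eq, treeCurrent_eq, treeNumerator, treeNumerator]
    congr 2
    refine Finset.sum_congr rfl fun I hI => ?_
    have hI' := Finset.mem_erase.1 hI
    have hIS := (Finset.mem_ssubsets.1 hI'.2).subset
    rw [IsSubtree.congr (S := I) fun i hi j hj => h i (hIS hi) j (hIS hj),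
      IsSubtree.congr (S := S \ I) fun i hi j hj =>
        h i (Finset.sdiff_subset hi) j (Finset.sdiff_subset hj),
      ih I (Finset.mem_ssubsets.1 hI'.2) fun i hi j hj => h i (hIS hi) j (hIS hj),
      splitFactor, splitFactor,
      crossSum_congr fun i hi j hj => h i (hIS hi) j (Finset.sdiff_subset hj)]

/-- The split factors of a tree on `S` add up to `S^2`. -/
theorem sum_splitFactor (f : V → ℂ)
    (hf : ∀ i j, bracket (ang x i) (ang x j) =
      (f j - f i) * (bracket (one x) (ang x i) * bracket (one x) (ang x j)))
    {Γ : SimpleGraph V} {S : Finset V} (hΓ : IsTreeOn Γ S) :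
    (1 / 2) * ∑ I ∈ S.ssubsets.erase ∅, (if IsSubtree Γ I ∧ IsSubtree Γ (S \ I) then
      splitFactor x f Γ I (S \ I) else 0) = sqr (mom x S) := by
  obtain ⟨v, hv⟩ := hΓ.1.nonempty
  have hgrow := hΓ.growsTo (isSubtree_singleton Γ v) (by simpa using hv)
  have tele := hgrow.sum_crossSum f
  have h1 : ∑ I ∈ S.ssubsets.erase ∅, (if IsSubtree Γ I ∧ IsSubtree Γ (S \ I) then
      splitFactor x f Γ I (S \ I) else 0) = ∑ I ∈ S.powerset, ∑ k ∈ S, ∑ l ∈ S,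
      (if k ∈ I ∧ l ∉ I ∧ IsSubtree Γ I ∧ IsSubtree Γ (S \ I) then
        crossSum Γ f I (S \ I) else 0) * (bracket (one x) (ang x k) *
          bracket (squ x k) (squ x l) * bracket (one x) (ang x l)) := by
    have hsub : S.ssubsets.erase ∅ ⊆ S.powerset := fun I hI =>
      Finset.mem_powerset.2 (mem_ssubsets_erase.1 hI).1
    rw [← Finset.sum_subset hsub]
    · refine Finset.sum_congr rfl fun I hI => ?_
      have hIS := (mem_ssubsets_erase.1 hI).1
      by_cases hc : IsSubtree Γ I ∧ IsSubtree Γ (S \ I)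
      swap
      · rw [if_neg hc]
        symm
        refine Finset.sum_eq_zero fun k _ => Finset.sum_eq_zero fun l _ => ?_
        rw [if_neg fun h => hc h.2.2, zero_mul]
      rw [if_pos hc, splitFactor, sandwich₂_mom_mom, Finset.mul_sum, ← Finset.sum_neg_distrib,
        ← Finset.sum_subset hIS]
      · refine Finset.sum_congr rfl fun k hk => ?_
        rw [Finset.mul_sum, ← Finset.sum_neg_distrib,
          ← Finset.sum_subset (Finset.sdiff_subset : S \ I ⊆ S)]
        · refine Finset.sum_congr rfl fun l hl => ?_
          rw [if_pos ⟨hk, (Finset.mem_sdiff.1 hl).2, hc⟩, bracket_swap (ang x l) (one x)]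
          ring
        · intro l hl hl'
          rw [if_neg, zero_mul]
          exact fun h => hl' (Finset.mem_sdiff.2 ⟨hl, h.2.1⟩)
      · intro k _ hk
        refine Finset.sum_eq_zero fun l _ => ?_
        rw [if_neg fun h => hk h.1, zero_mul]
    · intro I hI hI'
      refine Finset.sum_eq_zero fun k _ => Finset.sum_eq_zero fun l _ => ?_
      rw [if_neg, zero_mul]
      exact fun h => hI' (mem_ssubsets_erase.2
        ⟨Finset.mem_powerset.1 hI, h.2.2.1.nonempty, h.2.2.2.nonempty⟩)
  rw [h1, Finset.sum_comm, sqr_mom]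
  congr 1
  refine Finset.sum_congr rfl fun k hk => ?_
  rw [Finset.sum_comm]
  refine Finset.sum_congr rfl fun l hl => ?_
  rw [← Finset.sum_mul, tele k hk l hl, hf k l]
  ring

variable [Fintype V]

/-- The weight `J(Γ)` of a tree `Γ` with vertex set `S`. -/
noncomputable def treeWeightOn (Γ : SimpleGraph V) (S : Finset V) : ℂ :=
  (∏ i ∈ S, bracket (one x) (ang x i) ^ (2 * (deg Γ S i : ℤ) - 4)) *
    ∏ e ∈ Γ.edgeFinset, edgeFactor x e

theorem treeWeightOn_univ (Γ : SimpleGraph V) :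
    treeWeightOn x Γ Finset.univ = treeWeight x Γ := by
  unfold treeWeightOn treeWeight
  simp only [deg_univ]

/-- Joining two trees by an edge multiplies their weights by the weight of that edge. -/
theorem treeWeightOn_joinAt {Γ₁ Γ₂ : SimpleGraph V} {I C : Finset V} {i j : V}
    (hq : ∀ i, bracket (one x) (ang x i) ≠ 0)
    (h : Disjoint I C) (h₁ : SupportedOn Γ₁ I) (h₂ : SupportedOn Γ₂ C) (hi : i ∈ I)
    (hj : j ∈ C) : treeWeightOn x (joinAt Γ₁ Γ₂ i j) (I ∪ C) =
      treeWeightOn x Γ₁ I * treeWeightOn x Γ₂ C *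
        (bracket (one x) (ang x i) ^ 2 * bracket (one x) (ang x j) ^ 2 *
          (bracket (squ x i) (squ x j) / bracket (ang x i) (ang x j))) := by
  have aux : ∀ {Γ₁ Γ₂ : SimpleGraph V} {I C : Finset V} {i j : V}, Disjoint I C →
      SupportedOn Γ₁ I → SupportedOn Γ₂ C → i ∈ I → j ∈ C →
      ∏ v ∈ I, bracket (one x) (ang x v) ^ (2 * (deg (joinAt Γ₁ Γ₂ i j) (I ∪ C) v : ℤ) - 4) =
        (∏ v ∈ I, bracket (one x) (ang x v) ^ (2 * (deg Γ₁ I v : ℤ) - 4)) *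
          bracket (one x) (ang x i) ^ 2 := by
    intro Γ₁ Γ₂ I C i j h h₁ h₂ hi hj
    have : ∀ v ∈ I, bracket (one x) (ang x v) ^
        (2 * (deg (joinAt Γ₁ Γ₂ i j) (I ∪ C) v : ℤ) - 4) =
        bracket (one x) (ang x v) ^ (2 * (deg Γ₁ I v : ℤ) - 4) *
          if i = v then bracket (one x) (ang x i) ^ 2 else 1 := by
      intro v hv
      rw [deg_union h, deg_joinAt h h₁ h₂ hi hj v hv,
        deg_congr (joinAt_adj_left (Γ₁ := Γ₁) (i := i) h h₂ hj v hv)]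
      split_ifs with hiv
      · subst hiv
        rw [← zpow_natCast (bracket (one x) (ang x i)) 2, ← zpow_add₀ (hq i)]
        congr 1
        push_cast
        ring
      · rw [mul_one, add_zero]
    rw [Finset.prod_congr rfl this, Finset.prod_mul_distrib, Finset.prod_ite_eq, if_pos hi]
  have a1 := aux h h₁ h₂ hi hj
  have a2 := aux h.symm h₂ h₁ hj hi
  rw [← joinAt_comm, Finset.union_comm] at a2
  unfold treeWeightOn
  rw [Finset.prod_union h, a1, a2, edgeFinset_joinAt h h₁ h₂ hi hj]
  have : edgeFactor x s(i, j) = bracket (squ x i) (squ x j) / bracket (ang x i) (ang x j) := rfl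
  rw [this]
  ring

/-- The cubic vertex of the recursion, evaluated on sums over trees: one of the two factors
`(q|I|C|q)` joins the two trees by an edge. -/
theorem sandwich₂_sq_mul_sum_treesOn (f : V → ℂ)
    (hq : ∀ i, bracket (one x) (ang x i) ≠ 0)
    (hne : ∀ i j, i ≠ j → bracket (ang x i) (ang x j) ≠ 0)
    (hf : ∀ i j, bracket (ang x i) (ang x j) =
      (f j - f i) * (bracket (one x) (ang x i) * bracket (one x) (ang x j)))
    {I C : Finset V} (h : Disjoint I C) (g : SimpleGraph V → ℂ)
    (hg : ∀ Γ Γ' : SimpleGraph V, (∀ i ∈ I, ∀ j ∈ I, (Γ.Adj i j ↔ Γ'.Adj i j)) → g Γ = g Γ') :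
    sandwich₂ (one x) (mom x I) (mom x C) (one x) ^ 2 *
      (∑ Γ ∈ treesOn I, treeWeightOn x Γ I * g Γ) * (∑ Γ ∈ treesOn C, treeWeightOn x Γ C) =
    ∑ Γ ∈ treesOn (I ∪ C), treeWeightOn x Γ (I ∪ C) *
      if IsSubtree Γ I ∧ IsSubtree Γ C then splitFactor x f Γ I C * g Γ else 0 := by
  simp only [mul_ite, mul_zero]
  rw [sum_treesOn_union h, mul_assoc, Finset.sum_mul_sum, Finset.mul_sum]
  refine Finset.sum_congr rfl fun Γ₁ hΓ₁ => ?_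
  rw [Finset.mul_sum]
  refine Finset.sum_congr rfl fun Γ₂ hΓ₂ => ?_
  rw [mem_treesOn] at hΓ₁ hΓ₂
  have key : ∀ i ∈ I, ∀ j ∈ C, treeWeightOn x (joinAt Γ₁ Γ₂ i j) (I ∪ C) *
      (splitFactor x f (joinAt Γ₁ Γ₂ i j) I C * g (joinAt Γ₁ Γ₂ i j)) =
      (sandwich₂ (one x) (mom x I) (mom x C) (one x) * treeWeightOn x Γ₁ I * g Γ₁ *
        treeWeightOn x Γ₂ C) * (bracket (one x) (ang x i) * bracket (squ x i) (squ x j) *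
          bracket (ang x j) (one x)) := by
    intro i hi j hj
    have hij : i ≠ j := by rintro rfl; exact Finset.disjoint_left.1 h hi hj
    have hcross : crossSum (joinAt Γ₁ Γ₂ i j) f I C = f j - f i := by
      unfold crossSum
      have : ∀ a ∈ I, (∑ b ∈ C, if (joinAt Γ₁ Γ₂ i j).Adj a b then f b - f a else 0) =
          if i = a then f j - f i else 0 := by
        intro a ha
        have h' : ∀ b ∈ C, (if (joinAt Γ₁ Γ₂ i j).Adj a b then f b - f a else 0) =
            if j = b then (if i = a then f j - f i else 0) else 0 := by
          intro b hb
          rw [joinAt_adj_cross h hΓ₁.1 hΓ₂.1 hi a ha b hb]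
          simp only [eq_comm (a := a), eq_comm (a := b)]
          by_cases h1 : i = a <;> by_cases h2 : j = b <;> simp [h1, h2]
        rw [Finset.sum_congr rfl h', Finset.sum_ite_eq, if_pos hj]
      rw [Finset.sum_congr rfl this, Finset.sum_ite_eq, if_pos hi]
    rw [treeWeightOn_joinAt x hq h hΓ₁.1 hΓ₂.1 hi hj, splitFactor, hcross,
      hg _ Γ₁ (joinAt_adj_left h hΓ₂.1 hj), bracket_swap (ang x j) (one x)]
    have h1 := hne i j hij
    have h2 : f j - f i ≠ 0 := by
      intro h0
      rw [hf, h0, zero_mul] at h1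
      exact h1 rfl
    rw [hf i j]
    have := hq i
    have := hq j
    field_simp
  rw [Finset.sum_congr rfl fun i hi => Finset.sum_congr rfl fun j hj => key i hi j hj]
  simp only [← Finset.mul_sum]
  rw [← sandwich₂_mom_mom]
  ring

theorem treesOn_singleton (i : V) : treesOn ({i} : Finset V) = {⊥} := by
  ext Γ
  rw [mem_treesOn, Finset.mem_singleton]
  constructor
  · rintro ⟨hs, -⟩
    ext a b
    simp only [SimpleGraph.bot_adj, iff_false]
    intro hab
    have ha := Finset.mem_singleton.1 (hs _ _ hab)
    have hb := Finset.mem_singleton.1 (hs _ _ hab.symm)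
    exact hab.ne (ha.trans hb.symm)
  · rintro rfl
    refine ⟨fun a b h => absurd h (by simp), isSubtree_singleton _ _, ?_⟩
    simp [deg]

/-- The all-plus current is the sum of the tree weights. -/
theorem plusCurrent_eq_sum (f : V → ℂ)
    (hq : ∀ i, bracket (one x) (ang x i) ≠ 0)
    (hne : ∀ i j, i ≠ j → bracket (ang x i) (ang x j) ≠ 0)
    (hf : ∀ i j, bracket (ang x i) (ang x j) =
      (f j - f i) * (bracket (one x) (ang x i) * bracket (one x) (ang x j)))
    (hplus : ∀ S : Finset V, 2 ≤ S.card → sqr (mom x S) ≠ 0) (S : Finset V) :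
    S.Nonempty → plusCurrent x S = ∑ Γ ∈ treesOn S, treeWeightOn x Γ S := by
  induction S using Finset.strongInduction with
  | H S ih =>
    intro hS
    by_cases h1 : S.card = 1
    · obtain ⟨i, rfl⟩ := Finset.card_eq_one.1 h1
      rw [plusCurrent_singleton, treesOn_singleton, Finset.sum_singleton]
      have hb : ∀ Γ : SimpleGraph V, Γ = ⊥ → ∏ e ∈ Γ.edgeFinset, edgeFactor x e = 1 := by
        intro Γ hΓ
        refine Finset.prod_eq_one fun e he => ?_
        rw [SimpleGraph.mem_edgeFinset, hΓ, SimpleGraph.edgeSet_bot] at he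
        exact he.elim
      rw [treeWeightOn, hb _ rfl]
      simp [deg, Finset.filter_singleton]
    · have h2 : 2 ≤ S.card := by
        have := hS.card_pos
        omega
      rw [plusCurrent_of_card_ne_one x h1, inv_mul_eq_iff_eq_mul₀ (hplus S h2)]
      have hsplit : ∀ I ∈ S.ssubsets.erase ∅,
          sandwich₂ (one x) (mom x I) (mom x (S \ I)) (one x) ^ 2
            * plusCurrent x I * plusCurrent x (S \ I) =
          ∑ Γ ∈ treesOn S, treeWeightOn x Γ S *
            if IsSubtree Γ I ∧ IsSubtree Γ (S \ I) then splitFactor x f Γ I (S \ I) else 0 := by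
        intro I hI
        have hI' := mem_ssubsets_erase.1 hI
        have hss := Finset.mem_ssubsets.1 (Finset.mem_erase.1 hI).2
        have := sandwich₂_sq_mul_sum_treesOn x f hq hne hf
          (Finset.disjoint_sdiff : Disjoint I (S \ I)) (fun _ => 1) (fun _ _ _ => rfl)
        simp only [mul_one, Finset.union_sdiff_of_subset hI'.1] at this
        rw [ih I hss hI'.2.1, ih (S \ I) (Finset.sdiff_ssubset hI'.1 hI'.2.1) hI'.2.2, this]
      rw [Finset.sum_congr rfl hsplit, Finset.sum_comm, Finset.mul_sum, Finset.mul_sum]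
      refine Finset.sum_congr rfl fun Γ hΓ => ?_
      rw [← Finset.mul_sum, ← sum_splitFactor x f hf (mem_treesOn.1 hΓ).2]
      ring

/-- The amputated all-but-one-plus current is the sum of the tree weights, multiplied by the
amputated currents of the single trees. -/
theorem oneMinusNumerator_eq_sum (f : V → ℂ) (p : Spinor)
    (hq : ∀ i, bracket (one x) (ang x i) ≠ 0)
    (hne : ∀ i j, i ≠ j → bracket (ang x i) (ang x j) ≠ 0)
    (hf : ∀ i j, bracket (ang x i) (ang x j) =
      (f j - f i) * (bracket (one x) (ang x i) * bracket (one x) (ang x j)))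
    (hplus : ∀ S : Finset V, 2 ≤ S.card → sqr (mom x S) ≠ 0) (S : Finset V) :
    S.Nonempty → oneMinusNumerator x p S =
      ∑ Γ ∈ treesOn S, treeWeightOn x Γ S * treeNumerator x p f Γ S := by
  have hJ := plusCurrent_eq_sum x f hq hne hf hplus
  induction S using Finset.strongInduction with
  | H S ih =>
    intro hS
    have hsplit : ∀ I ∈ S.ssubsets.erase ∅,
        sandwich₂ (one x) (mom x I) (mom x (S \ I)) (one x) ^ 2
          * oneMinusCurrent x p I * plusCurrent x (S \ I) =
        ∑ Γ ∈ treesOn S, treeWeightOn x Γ S *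
          if IsSubtree Γ I ∧ IsSubtree Γ (S \ I) then
            splitFactor x f Γ I (S \ I) * treeCurrent x p f Γ I else 0 := by
      intro I hI
      have hI' := mem_ssubsets_erase.1 hI
      have hss := Finset.mem_ssubsets.1 (Finset.mem_erase.1 hI).2
      have := sandwich₂_sq_mul_sum_treesOn x f hq hne hf
        (Finset.disjoint_sdiff : Disjoint I (S \ I)) (fun Γ => treeCurrent x p f Γ I)
        (fun Γ Γ' h => treeCurrent_congr x p f Γ Γ' I h)
      rw [Finset.union_sdiff_of_subset hI'.1] at this
      rw [← this, hJ (S \ I) hI'.2.2, oneMinusCurrent_eq, ih I hss hI'.2.1]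
      have e : ∑ Γ ∈ treesOn I, treeWeightOn x Γ I * treeCurrent x p f Γ I =
          (sqr (mom₁ x I))⁻¹ * ∑ Γ ∈ treesOn I, treeWeightOn x Γ I * treeNumerator x p f Γ I := by
        rw [Finset.mul_sum]
        refine Finset.sum_congr rfl fun Γ _ => ?_
        rw [treeCurrent_eq, mul_left_comm]
      rw [e]
    rw [oneMinusNumerator, Finset.sum_congr rfl hsplit, Finset.sum_comm, hJ S hS, Finset.mul_sum,
      ← Finset.sum_add_distrib]
    refine Finset.sum_congr rfl fun Γ _ => ?_
    rw [← Finset.mul_sum, treeNumerator]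
    ring

end

/-! ### The residue of the current -/

section

open scoped Classical

variable {V : Type*} {x : Kinematics V} {z zt : Spinor}

theorem crossSum_mul_const (Γ : SimpleGraph V) (r : V → ℂ) (c : ℂ) (I C : Finset V) :
    crossSum Γ (fun k => r k * c) I C = crossSum Γ r I C * c := by
  unfold crossSum
  rw [Finset.sum_mul]
  refine Finset.sum_congr rfl fun i _ => ?_
  rw [Finset.sum_mul]
  refine Finset.sum_congr rfl fun j _ => ?_
  split_ifs <;> ring

/-- The ratio `(0 k) / (1 k)`. -/
noncomputable def ratio (x : Kinematics V) (z : Spinor) (k : V) : ℂ :=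
  bracket z (ang x k) / bracket (one x) (ang x k)

/-- The potential of the edge weights: `(ij) / ((q i)(q j))` is its increment from `i` to `j`. -/
theorem bracket_ang_eq (h01 : bracket z (one x) ≠ 0)
    (h1 : ∀ i, bracket (one x) (ang x i) ≠ 0) (i j : V) : bracket (ang x i) (ang x j) =
      (ratio x z j * (bracket (one x) z)⁻¹ - ratio x z i * (bracket (one x) z)⁻¹) *
        (bracket (one x) (ang x i) * bracket (one x) (ang x j)) := by
  have h01' : bracket (one x) z ≠ 0 := by
    rw [bracket_swap]; exact neg_ne_zero.2 h01
  have := h1 i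
  have := h1 j
  unfold ratio
  field_simp
  rw [schouten, bracket_swap (ang x i) (one x),
    bracket_swap (ang x i) z, bracket_swap (ang x j) z, bracket_swap (ang x j) (one x)]
  ring

theorem sandwich₂_one_mom (S : Finset V) (Q : Momentum) (m : Spinor) :
    sandwich₂ (one x) (mom x S) Q m = sandwich₂ (one x) (mom₁ x S) Q m := by
  rw [mom₁, sandwich₂_add_left, sandwich₂_nullMom_left, bracket_self]
  ring

variable [Fintype V]

/-- Momentum conservation, for the gravitons outside `I`. -/
theorem mom_compl_eq (honshell : nullMom z zt = -mom₁ x Finset.univ) (I : Finset V) :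
    mom x (Finset.univ \ I) = -(nullMom z zt + mom₁ x I) := by
  have h := mom_union x (Finset.disjoint_sdiff : Disjoint I (Finset.univ \ I))
  rw [Finset.union_sdiff_of_subset (Finset.subset_univ I)] at h
  rw [honshell, mom₁, mom₁, h]
  abel

/-- By momentum conservation, `∑ k ∉ I, (0k)/(qk) (q|I|k|q)` is a multiple of `(1+I)^2`. -/
theorem sum_ratio_mul_sandwich₂ (honshell : nullMom z zt = -mom₁ x Finset.univ)
    (h1 : ∀ i, bracket (one x) (ang x i) ≠ 0) (I : Finset V) :
    ∑ k ∈ Finset.univ \ I, ratio x z k *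
      (bracket (slashLeft (one x) (mom x I)) (squ x k) * bracket (ang x k) (one x)) =
      sqr (mom₁ x I) * bracket (one x) z := by
  have h : ∀ k, ratio x z k *
      (bracket (slashLeft (one x) (mom x I)) (squ x k) * bracket (ang x k) (one x)) =
      bracket (slashLeft (one x) (mom x I)) (squ x k) * bracket (ang x k) z := by
    intro k
    have := h1 k
    rw [ratio, bracket_swap (ang x k) (one x), bracket_swap (ang x k) z]
    field_simp
  simp only [h]
  rw [← sandwich₂_mom_right, mom_compl_eq honshell I, sandwich₂_neg_right, sandwich₂_add_right,
    sandwich₂_nullMom_right, bracket_self, sandwich₂_one_mom, sandwich₂_self]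
  ring

/-- On shell, the weights `outerWeight` solve the transposed recursion: the wave equation for
the graviton `0`, in the background of the gravitons outside `I`. -/
theorem sqr_mul_outerWeight (honshell : nullMom z zt = -mom₁ x Finset.univ)
    (h01 : bracket z (one x) ≠ 0)
    (h0 : ∀ i, bracket z (ang x i) ≠ 0) (h1 : ∀ i, bracket (one x) (ang x i) ≠ 0)
    {Γ : SimpleGraph V} {I : Finset V} (hΓ : IsTreeOn Γ Finset.univ) (hI : IsSubtree Γ I) :
    (∑ C ∈ (Finset.univ \ I).powerset, if IsSubtree Γ C then
      splitFactor x (fun k => ratio x z k * (bracket (one x) z)⁻¹) Γ I C *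
        outerWeight Γ (ratio x z) Finset.univ (I ∪ C) else 0) =
      sqr (mom₁ x I) * outerWeight Γ (ratio x z) Finset.univ I := by
  have h01' : bracket (one x) z ≠ 0 := by
    rw [bracket_swap]; exact neg_ne_zero.2 h01
  have hr : ∀ v, ratio x z v ≠ 0 := fun v => div_ne_zero (h0 v) (h1 v)
  have hgrow := hΓ.growsTo hI (Finset.subset_univ I)
  have hsum := hgrow.sum_crossSum_mul_outerWeight _ hr
  set b : V → ℂ := fun k =>
    bracket (slashLeft (one x) (mom x I)) (squ x k) * bracket (ang x k) (one x) with hb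
  have h2 : ∀ C ∈ (Finset.univ \ I).powerset, (if IsSubtree Γ C then
      splitFactor x (fun k => ratio x z k * (bracket (one x) z)⁻¹) Γ I C *
        outerWeight Γ (ratio x z) Finset.univ (I ∪ C) else 0) =
      ∑ k ∈ Finset.univ \ I, (-(b k * (bracket (one x) z)⁻¹)) *
        if IsSubtree Γ C ∧ k ∈ C then crossSum Γ (ratio x z) I C *
          outerWeight Γ (ratio x z) Finset.univ (I ∪ C) else 0 := by
    intro C hC
    by_cases hcon : IsSubtree Γ C
    swap
    · simp [hcon]
    rw [← Finset.sum_subset (Finset.mem_powerset.1 hC), if_pos hcon, splitFactor,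
      crossSum_mul_const, sandwich₂_mom_right, Finset.mul_sum, ← Finset.sum_neg_distrib,
      Finset.sum_mul]
    · refine Finset.sum_congr rfl fun k hk => ?_
      rw [if_pos ⟨hcon, hk⟩]
      ring
    · intro k _ hk
      rw [if_neg fun h => hk h.2, mul_zero]
  rw [Finset.sum_congr rfl h2, Finset.sum_comm]
  have h3 : ∀ k ∈ Finset.univ \ I, (∑ C ∈ (Finset.univ \ I).powerset,
      (-(b k * (bracket (one x) z)⁻¹)) * if IsSubtree Γ C ∧ k ∈ C then
        crossSum Γ (ratio x z) I C * outerWeight Γ (ratio x z) Finset.univ (I ∪ C) else 0) =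
      (ratio x z k * b k) * ((bracket (one x) z)⁻¹ * outerWeight Γ (ratio x z) Finset.univ I) := by
    intro k hk
    rw [← Finset.mul_sum, hsum k hk]
    ring
  rw [Finset.sum_congr rfl h3, ← Finset.sum_mul, hb, sum_ratio_mul_sandwich₂ honshell h1]
  field_simp

/-- Pairs of disjoint subtrees `I`, `C` correspond to splittings of `I ∪ C`. -/
theorem sum_sum_sdiff_powerset (h : Finset V → Finset V → ℂ) :
    ∑ I : Finset V, ∑ C ∈ (Finset.univ \ I).powerset, h I C =
      ∑ S : Finset V, ∑ I ∈ S.powerset, h I (S \ I) := by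
  rw [Finset.sum_sigma', Finset.sum_sigma']
  refine Finset.sum_bij' (fun t _ => ⟨t.1 ∪ t.2, t.1⟩) (fun t _ => ⟨t.2, t.1 \ t.2⟩)
    ?_ ?_ ?_ ?_ ?_
  · rintro ⟨I, C⟩ -
    simp only [Finset.mem_sigma, Finset.mem_univ, true_and, Finset.mem_powerset]
    exact Finset.subset_union_left
  · rintro ⟨S, I⟩ -
    simp only [Finset.mem_sigma, Finset.mem_univ, true_and, Finset.mem_powerset]
    exact Finset.sdiff_subset_sdiff (Finset.subset_univ S) subset_rfl
  · rintro ⟨I, C⟩ ht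
    simp only [Finset.mem_sigma, Finset.mem_univ, true_and, Finset.mem_powerset] at ht
    have hd : Disjoint I C := Finset.disjoint_of_subset_right ht Finset.disjoint_sdiff
    simp only [Finset.union_sdiff_cancel_left hd]
  · rintro ⟨S, I⟩ ht
    simp only [Finset.mem_sigma, Finset.mem_univ, true_and, Finset.mem_powerset] at ht
    simp only [Finset.union_sdiff_of_subset ht]
  · rintro ⟨I, C⟩ ht
    simp only [Finset.mem_sigma, Finset.mem_univ, true_and, Finset.mem_powerset] at ht
    have hd : Disjoint I C := Finset.disjoint_of_subset_right ht Finset.disjoint_sdiff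
    simp only [Finset.union_sdiff_cancel_left hd]

/-- Summing the recursion against the solution of the transposed one, the
amputated current of a tree becomes a sum of the sources over its subtrees. -/
theorem treeNumerator_eq_sum_source (honshell : nullMom z zt = -mom₁ x Finset.univ)
    (h01 : bracket z (one x) ≠ 0)
    (h0 : ∀ i, bracket z (ang x i) ≠ 0) (h1 : ∀ i, bracket (one x) (ang x i) ≠ 0)
    (hminus : ∀ S : Finset V, S.Nonempty → S ≠ Finset.univ → sqr (mom₁ x S) ≠ 0)
    (p : Spinor) {Γ : SimpleGraph V} (hΓ : IsTreeOn Γ Finset.univ) :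
    treeNumerator x p (fun k => ratio x z k * (bracket (one x) z)⁻¹) Γ Finset.univ =
      ∑ I : Finset V, if IsSubtree Γ I then
        outerWeight Γ (ratio x z) Finset.univ I * minusSource x p I else 0 := by
  set f : V → ℂ := fun k => ratio x z k * (bracket (one x) z)⁻¹ with hf
  set G : Finset V → ℂ := outerWeight Γ (ratio x z) Finset.univ with hG
  have hG1 : G Finset.univ = 1 := outerWeight_self _ _ _
  -- the terms of both recursions
  set h : Finset V → Finset V → ℂ := fun I C => if IsSubtree Γ I ∧ IsSubtree Γ C then
    splitFactor x f Γ I C * treeCurrent x p f Γ I * G (I ∪ C) else 0 with hh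
  have hdouble := sum_sum_sdiff_powerset h
  have hleft : ∀ I : Finset V, ∑ C ∈ (Finset.univ \ I).powerset, h I C =
      if IsSubtree Γ I then sqr (mom₁ x I) * G I * treeCurrent x p f Γ I else 0 := by
    intro I
    by_cases hI : IsSubtree Γ I
    · rw [if_pos hI, hG, ← sqr_mul_outerWeight honshell h01 h0 h1 hΓ hI, Finset.sum_mul]
      refine Finset.sum_congr rfl fun C _ => ?_
      by_cases hC : IsSubtree Γ C
      · simp only [hh, hI, hC, and_self, if_true, hf, hG]
        ring
      · simp [hh, hC]
    · rw [if_neg hI]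
      exact Finset.sum_eq_zero fun C _ => if_neg fun h => hI h.1
  have hright : ∀ S : Finset V, ∑ I ∈ S.powerset, h I (S \ I) =
      if IsSubtree Γ S then G S * (treeNumerator x p f Γ S - minusSource x p S) else 0 := by
    intro S
    by_cases hS : IsSubtree Γ S
    · rw [if_pos hS, treeNumerator, add_sub_cancel_left, Finset.mul_sum,
        ← Finset.sum_subset (s₁ := S.ssubsets.erase ∅)]
      · refine Finset.sum_congr rfl fun I hI => ?_
        simp only [hh, Finset.union_sdiff_of_subset (mem_ssubsets_erase.1 hI).1]
        split_ifs <;> ring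
      · exact fun I hI => Finset.mem_powerset.2 (mem_ssubsets_erase.1 hI).1
      · intro I hI hI'
        refine if_neg fun hc => hI' (mem_ssubsets_erase.2
          ⟨Finset.mem_powerset.1 hI, hc.1.nonempty, hc.2.nonempty⟩)
    · -- without an edge between the two parts, the split factor vanishes
      rw [if_neg hS]
      refine Finset.sum_eq_zero fun I hI => ?_
      simp only [hh]
      split_ifs with hc
      swap
      · rfl
      have : crossSum Γ f I (S \ I) = 0 := by
        refine crossSum_eq_zero fun i hi j hj hij => hS ?_
        rw [← Finset.union_sdiff_of_subset (Finset.mem_powerset.1 hI)]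
        exact hc.1.union hc.2 hi hj hij
      rw [splitFactor, this]
      ring
  simp only [hleft, hright] at hdouble
  have huniv := hΓ.1
  have hsplit : ∀ g : Finset V → ℂ, ∑ S : Finset V, g S =
      g Finset.univ + ∑ S ∈ Finset.univ.erase Finset.univ, g S := fun g =>
    (Finset.add_sum_erase _ g (Finset.mem_univ _)).symm
  -- at the top, `(1+K)^2` vanishes
  have htop : sqr (mom₁ x (Finset.univ : Finset V)) = 0 := by
    rw [← sqr_neg, ← honshell, sqr_nullMom]
  rw [hsplit, hsplit (fun S => if IsSubtree Γ S then G S * _ else 0), if_pos huniv, if_pos huniv,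
    htop, hG1] at hdouble
  rw [hsplit, if_pos huniv, hG1]
  have hrest : ∀ S ∈ (Finset.univ : Finset (Finset V)).erase Finset.univ,
      (if IsSubtree Γ S then sqr (mom₁ x S) * G S * treeCurrent x p f Γ S else 0) =
      (if IsSubtree Γ S then G S * (treeNumerator x p f Γ S - minusSource x p S) else 0) +
      (if IsSubtree Γ S then G S * minusSource x p S else 0) := by
    intro S hS
    split_ifs with hc
    · rw [treeCurrent_eq]
      have := hminus S hc.nonempty (Finset.mem_erase.1 hS).1
      field_simp
      ring
    · simp
  rw [Finset.sum_congr rfl hrest, Finset.sum_add_distrib] at hdouble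
  linear_combination -hdouble

/-- The residue of the current of a single tree. -/
theorem treeNumerator_onshell (honshell : nullMom z zt = -mom₁ x Finset.univ)
    (h01 : bracket z (one x) ≠ 0)
    (h0 : ∀ i, bracket z (ang x i) ≠ 0) (h1 : ∀ i, bracket (one x) (ang x i) ≠ 0)
    (hminus : ∀ S : Finset V, S.Nonempty → S ≠ Finset.univ → sqr (mom₁ x S) ≠ 0)
    (p : Spinor) (hp₁ : bracket (oneT x) p ≠ 0) {Γ : SimpleGraph V}
    (hΓ : IsTreeOn Γ Finset.univ) :
    treeNumerator x p (fun k => ratio x z k * (bracket (one x) z)⁻¹) Γ Finset.univ =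
      bracket z (one x) ^ 2 * outerWeight Γ (ratio x z) Finset.univ ∅ := by
  rw [treeNumerator_eq_sum_source honshell h01 h0 h1 hminus p hΓ]
  have hr : ∀ v, ratio x z v ≠ 0 := fun v => div_ne_zero (h0 v) (h1 v)
  set a : V → ℂ := fun k => bracket (one x) (ang x k) * bracket (squ x k) p with ha
  have h2 : ∀ I : Finset V, (if IsSubtree Γ I then
      outerWeight Γ (ratio x z) Finset.univ I * minusSource x p I else 0) =
      ∑ k, ∑ l, (a k * a l * (bracket (oneT x) p ^ 2)⁻¹) *
        if IsSubtree Γ I ∧ k ∈ I ∧ l ∈ I then outerWeight Γ (ratio x z) Finset.univ I else 0 := by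
    intro I
    by_cases hI : IsSubtree Γ I
    swap
    · simp [hI]
    rw [if_pos hI, minusSource, sandwich₁_mom, sq (∑ k ∈ I, _), Finset.sum_mul_sum,
      ← Finset.sum_subset (Finset.subset_univ I), Finset.sum_div, Finset.mul_sum]
    · refine Finset.sum_congr rfl fun k hk => ?_
      rw [← Finset.sum_subset (Finset.subset_univ I), Finset.sum_div, Finset.mul_sum]
      · refine Finset.sum_congr rfl fun l hl => ?_
        rw [if_pos ⟨hI, hk, hl⟩, div_eq_mul_inv]
        ring
      · intro l _ hl
        rw [if_neg fun h => hl h.2.2, mul_zero]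
    · intro k _ hk
      refine Finset.sum_eq_zero fun l _ => ?_
      rw [if_neg fun h => hk h.2.1, mul_zero]
  rw [Finset.sum_congr rfl fun I _ => h2 I, Finset.sum_comm]
  have h3 : ∀ k l, ∑ I : Finset V, (if IsSubtree Γ I ∧ k ∈ I ∧ l ∈ I then
      outerWeight Γ (ratio x z) Finset.univ I else 0) =
      ratio x z k * ratio x z l * outerWeight Γ (ratio x z) Finset.univ ∅ := by
    intro k l
    rw [← (hΓ.growsTo (isSubtree_singleton Γ k) (Finset.subset_univ _)).sum_outerWeight _ hr l
      (Finset.mem_univ l), Finset.powerset_univ]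
  have h4 : ∑ k, a k * ratio x z k = -(bracket z (one x) * bracket (oneT x) p) := by
    have : ∀ k, a k * ratio x z k = bracket z (ang x k) * bracket (squ x k) p := by
      intro k
      have := h1 k
      simp only [ha, ratio]
      field_simp
    simp only [this]
    rw [← sandwich₁_mom, ← Finset.sdiff_empty (s := Finset.univ), mom_compl_eq honshell,
      sandwich₁_neg, sandwich₁_add, sandwich₁_nullMom, bracket_self, mom₁, sandwich₁_add,
      sandwich₁_nullMom, sandwich₁_mom]
    simp
  have h5 : ∀ k, ∑ I : Finset V, ∑ l, (a k * a l * (bracket (oneT x) p ^ 2)⁻¹) *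
        (if IsSubtree Γ I ∧ k ∈ I ∧ l ∈ I then
          outerWeight Γ (ratio x z) Finset.univ I else 0) =
      ∑ l, (a k * ratio x z k) * (a l * ratio x z l) *
        ((bracket (oneT x) p ^ 2)⁻¹ * outerWeight Γ (ratio x z) Finset.univ ∅) := by
    intro k
    rw [Finset.sum_comm]
    refine Finset.sum_congr rfl fun l _ => ?_
    rw [← Finset.mul_sum, h3]
    ring
  rw [Finset.sum_congr rfl fun k _ => h5 k]
  simp only [← Finset.sum_mul]
  rw [← Finset.sum_mul_sum, h4]
  field_simp

end

/-! ### The residue of the top term of a tree -/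

section

open scoped Classical

variable {V : Type*}

theorem IsSubtree.one_le_deg {Γ : SimpleGraph V} {S : Finset V} (hS : IsSubtree Γ S)
    (h2 : 2 ≤ S.card) {v : V} (hv : v ∈ S) : 1 ≤ deg Γ S v := by
  obtain ⟨i, hi, j, hj, -, hij⟩ := ((isSubtree_iff Γ S).1 hS).2 {v} (by simpa using hv) (by simp)
    (by rintro rfl; simp at h2)
  rw [Finset.mem_singleton] at hi
  subst hi
  exact Finset.card_pos.2 ⟨j, Finset.mem_filter.2 ⟨hj, hij⟩⟩

theorem IsTreeOn.two_le_card_ends {Γ : SimpleGraph V} {S : Finset V} (hS : IsTreeOn Γ S)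
    (h2 : 2 ≤ S.card) : 2 ≤ (ends Γ S).card := by
  have h : ∑ v ∈ S, 2 ≤ ∑ v ∈ S, (deg Γ S v + if deg Γ S v = 1 then 1 else 0) := by
    refine Finset.sum_le_sum fun v hv => ?_
    have := hS.1.one_le_deg h2 hv
    split_ifs <;> omega
  rw [Finset.sum_add_distrib, ← Finset.card_filter, Finset.sum_const, smul_eq_mul] at h
  have := hS.2
  unfold ends
  omega

theorem IsTreeOn.stem_nonempty {Γ : SimpleGraph V} {S : Finset V} (hS : IsTreeOn Γ S)
    (h2 : S.card ≠ 2) : (stem Γ S).Nonempty := by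
  by_contra hne
  rw [Finset.not_nonempty_iff_eq_empty, stem, Finset.filter_eq_empty_iff] at hne
  have h : ∑ v ∈ S, deg Γ S v = S.card := by
    rw [Finset.sum_congr rfl fun v hv => not_not.1 (hne hv)]
    simp
  have := hS.2
  omega

theorem disjoint_stem_ends (Γ : SimpleGraph V) (S : Finset V) :
    Disjoint (stem Γ S) (ends Γ S) := (Finset.disjoint_filter_filter_not S S _).symm

theorem stem_union_ends (Γ : SimpleGraph V) (S : Finset V) : stem Γ S ∪ ends Γ S = S := by
  rw [Finset.union_comm]
  exact Finset.filter_union_filter_not_eq _ S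

/-- A sum over the orderings of `T` is a sum over injective functions. -/
theorem sum_orderings [Fintype V] {n : ℕ} {T : Finset V} (hT : T.card = n)
    (g : (Fin n → V) → ℂ) : ∑ η : Fin n ≃ T, g (fun t => (η t : V)) =
      ∑ f : Fin n → V, if Function.Injective f ∧ ∀ t, f t ∈ T then g f else 0 := by
  rw [← Finset.sum_filter]
  refine Finset.sum_bij (fun η _ t => (η t : V)) ?_ ?_ ?_ ?_
  · intro η _
    simp only [Finset.mem_filter, Finset.mem_univ, true_and]
    exact ⟨Subtype.val_injective.comp η.injective, fun t => (η t).2⟩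
  · intro η _ η' _ h
    ext t
    exact congrFun h t
  · intro f hf
    simp only [Finset.mem_filter, Finset.mem_univ, true_and] at hf
    have hinj : Function.Injective (fun t => (⟨f t, hf.2 t⟩ : T)) := by
      intro a b hab
      exact hf.1 (congrArg Subtype.val hab)
    have hbij := (Fintype.bijective_iff_injective_and_card _).2 ⟨hinj, by simp [hT]⟩
    exact ⟨Equiv.ofBijective _ hbij, Finset.mem_univ _, rfl⟩
  · intro η _
    rfl

variable {x : Kinematics V}

/-- `(1+I)^2 φ(Γ_I)`, the sum over the orderings of the ends without the overall propagator. -/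
noncomputable def phiNumerator (x : Kinematics V) (p : Spinor) (Γ : SimpleGraph V) (δ : ℕ → V)
    (I : Finset V) : ℂ :=
  if I.card = 1 then minusSource x p I
  else if I.card = 2 then
    ∏ i ∈ I, sandwich₂ (one x) (mom x {i}) (mom x (I.erase i)) (one x) / sqr (mom₁ x {i})
  else ∑ η : Fin (ends Γ I).card ≃ ends Γ I, ∏ t : Fin (ends Γ I).card,
    if (t : ℕ) = 0 ∨ (t : ℕ) + 1 = (ends Γ I).card then
      sandwich₂ (one x) (mom x {(η t : V)}) (mom x (grown Γ I η t)) (one x) /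
        sqr (mom₁ x (grown Γ I η t))
    else
      sandwich₂ (one x) (mom x {(η t : V)}) (mom₁ x (grown Γ I η t)) (ang x (δ t)) /
        (sqr (mom₁ x (grown Γ I η t)) * bracket (one x) (ang x (δ t)))

theorem phi_eq (h1 : ∀ i, bracket (one x) (ang x i) ≠ 0) (p : Spinor) (Γ : SimpleGraph V)
    (δ : ℕ → V) (I : Finset V) :
    phi x p Γ δ I = (sqr (mom₁ x I))⁻¹ * phiNumerator x p Γ δ I := by
  unfold phi phiNumerator
  split_ifs with hc1 hc2
  · obtain ⟨i, rfl⟩ := Finset.card_eq_one.1 hc1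
    rw [Finset.sum_singleton, minusSource, sandwich₁_mom, Finset.sum_singleton,
      sqr_mom₁_singleton]
    have := h1 i
    -- if `[1i] = 0`, both sides vanish
    rw [mul_inv, div_eq_mul_inv, div_eq_mul_inv, mul_inv]
    field_simp
  · rfl
  · rfl

theorem sandwich₂_smul_right (l : Spinor) (P Q : Momentum) (c : ℂ) (m : Spinor) :
    sandwich₂ l P Q (c • m) = c * sandwich₂ l P Q m := by
  simp [sandwich₂, slashLeft, slashRight, bracket]; ring

theorem sandwich₂_mom₁_one (l : Spinor) (P : Momentum) (S : Finset V) :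
    sandwich₂ l P (mom₁ x S) (one x) = sandwich₂ l P (mom x S) (one x) := by
  rw [mom₁, sandwich₂_add_right, sandwich₂_nullMom_right, bracket_self]
  ring

theorem sdiff_stem (Γ : SimpleGraph V) (S : Finset V) : S \ stem Γ S = ends Γ S := by
  conv_lhs => rw [← stem_union_ends Γ S]
  rw [stem_union_ends, ← Finset.union_sdiff_cancel_left (disjoint_stem_ends Γ S), stem_union_ends]

variable [Fintype V] {z zt : Spinor}

/-- Momentum conservation, for the gravitons outside `Ψ`. -/
theorem sum_bracket_slashRight (honshell : nullMom z zt = -mom₁ x Finset.univ) (d : Spinor)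
    (Ψ : Finset V) : ∑ k ∈ Finset.univ \ Ψ,
      bracket z (ang x k) * bracket (squ x k) (slashRight (mom₁ x Ψ) d) =
      sqr (mom₁ x Ψ) * bracket z d := by
  rw [← sandwich₂_mom_left, mom_compl_eq honshell, sandwich₂_neg_left, sandwich₂_add_left,
    sandwich₂_nullMom_left, bracket_self, sandwich₂_self]
  ring

/-- On shell, the sum over the orderings of the gravitons outside `Ψ` factorises, for
arbitrary spinors `d t`. Summing over the first one to be added to `1+Ψ`, momentum conservation
cancels the propagator `1/(1+Ψ)^2`. -/
theorem sum_orderings_onshell (honshell : nullMom z zt = -mom₁ x Finset.univ)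
    (h0 : ∀ i, bracket z (ang x i) ≠ 0)
    (hminus : ∀ S : Finset V, S.Nonempty → S ≠ Finset.univ → sqr (mom₁ x S) ≠ 0) (n : ℕ) :
    ∀ (Ψ : Finset V) (d : ℕ → Spinor), Ψ.Nonempty → (Finset.univ \ Ψ).card = n →
      (∑ f : Fin n → V, if Function.Injective f ∧ ∀ t, f t ∈ Finset.univ \ Ψ then
        ∏ t, sandwich₂ (one x) (mom x {f t})
            (mom₁ x (Ψ ∪ (Finset.univ.filter (fun s => s < t)).image f)) (d t) /
          sqr (mom₁ x (Ψ ∪ (Finset.univ.filter (fun s => s < t)).image f)) else 0) =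
      (∏ t ∈ Finset.range n, bracket z (d t)) *
        ∏ k ∈ Finset.univ \ Ψ, bracket (one x) (ang x k) / bracket z (ang x k) := by
  induction n with
  | zero =>
    intro Ψ d _ hc
    rw [Finset.card_eq_zero] at hc
    rw [hc]
    simp [Function.injective_of_subsingleton]
  | succ n ih =>
    intro Ψ d hΨ hc
    have hne : Ψ ≠ Finset.univ := by rintro rfl; simp at hc
    have hsq := hminus Ψ hΨ hne
    rw [← (Fin.consEquiv (fun _ : Fin (n + 1) => V)).sum_comp, Fintype.sum_prod_type]
    have hstep : ∀ v : V, (∑ f : Fin n → V,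
        if Function.Injective (Fin.consEquiv (fun _ : Fin (n + 1) => V) (v, f)) ∧
          ∀ t, Fin.consEquiv (fun _ : Fin (n + 1) => V) (v, f) t ∈ Finset.univ \ Ψ then
        ∏ t, sandwich₂ (one x) (mom x {Fin.consEquiv (fun _ : Fin (n + 1) => V) (v, f) t})
            (mom₁ x (Ψ ∪ (Finset.univ.filter (fun s => s < t)).image
              (Fin.consEquiv (fun _ : Fin (n + 1) => V) (v, f)))) (d t) /
          sqr (mom₁ x (Ψ ∪ (Finset.univ.filter (fun s => s < t)).image
            (Fin.consEquiv (fun _ : Fin (n + 1) => V) (v, f)))) else 0) =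
        if v ∈ Finset.univ \ Ψ then (bracket z (ang x v) *
          bracket (squ x v) (slashRight (mom₁ x Ψ) (d 0))) * ((sqr (mom₁ x Ψ))⁻¹ *
          (∏ t ∈ Finset.range n, bracket z (d (t + 1))) *
          ∏ k ∈ Finset.univ \ Ψ, bracket (one x) (ang x k) / bracket z (ang x k)) else 0 := by
      intro v
      have hfun : ∀ f : Fin n → V, Fin.consEquiv (fun _ : Fin (n + 1) => V) (v, f) =
        (Fin.cons v f : Fin (n + 1) → V) := fun f => rfl
      simp only [hfun]
      by_cases hv : v ∈ Finset.univ \ Ψ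
      swap
      · rw [if_neg hv]
        refine Finset.sum_eq_zero fun f _ => if_neg fun h => hv ?_
        exact h.2 0
      rw [if_pos hv]
      have hvΨ := (Finset.mem_sdiff.1 hv).2
      have hsd : Finset.univ \ insert v Ψ = (Finset.univ \ Ψ).erase v := Finset.sdiff_insert _ _ _
      have ih' := ih (insert v Ψ) (fun t => d (t + 1)) (by simp) (by
        rw [hsd, Finset.card_erase_of_mem hv, hc]
        rfl)
      have hterm : ∀ f : Fin n → V,
          (if Function.Injective (Fin.cons v f : Fin (n + 1) → V) ∧
            ∀ t, (Fin.cons v f : Fin (n + 1) → V) t ∈ Finset.univ \ Ψ then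
          ∏ t, sandwich₂ (one x) (mom x {(Fin.cons v f : Fin (n + 1) → V) t})
            (mom₁ x (Ψ ∪ (Finset.univ.filter (fun s => s < t)).image
              (Fin.cons v f : Fin (n + 1) → V))) (d t) /
          sqr (mom₁ x (Ψ ∪ (Finset.univ.filter (fun s => s < t)).image
            (Fin.cons v f : Fin (n + 1) → V))) else 0) =
          (sandwich₂ (one x) (mom x {v}) (mom₁ x Ψ) (d 0) / sqr (mom₁ x Ψ)) *
          (if Function.Injective f ∧ ∀ t, f t ∈ Finset.univ \ insert v Ψ then
            ∏ t, sandwich₂ (one x) (mom x {f t})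
              (mom₁ x (insert v Ψ ∪ (Finset.univ.filter (fun s => s < t)).image f)) (d (t + 1)) /
            sqr (mom₁ x (insert v Ψ ∪ (Finset.univ.filter (fun s => s < t)).image f))
            else 0) := by
        intro f
        have hcond : (Function.Injective (Fin.cons v f : Fin (n + 1) → V) ∧
            ∀ t, (Fin.cons v f : Fin (n + 1) → V) t ∈ Finset.univ \ Ψ) ↔
            (Function.Injective f ∧ ∀ t, f t ∈ Finset.univ \ insert v Ψ) := by
          rw [Fin.cons_injective_iff, Fin.forall_fin_succ, hsd]
          simp only [Fin.cons_zero, Fin.cons_succ, Finset.mem_erase, Set.mem_range, not_exists]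
          constructor
          · rintro ⟨⟨h1, h2⟩, h3, h4⟩
            exact ⟨h2, fun t => ⟨h1 t, h4 t⟩⟩
          · rintro ⟨h1, h2⟩
            exact ⟨⟨fun t => (h2 t).1, h1⟩, hv, fun t => (h2 t).2⟩
        by_cases hc' : Function.Injective f ∧ ∀ t, f t ∈ Finset.univ \ insert v Ψ
        swap
        · rw [if_neg (fun h => hc' (hcond.1 h)), if_neg hc', mul_zero]
        rw [if_pos (hcond.2 hc'), if_pos hc', Fin.prod_univ_succ]
        have hset : ∀ t : Fin n, Ψ ∪ (Finset.univ.filter (fun s => s < t.succ)).image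
            (Fin.cons v f : Fin (n + 1) → V) =
            insert v Ψ ∪ (Finset.univ.filter (fun s => s < t)).image f := by
          intro t
          ext w
          simp only [Finset.mem_union, Finset.mem_image, Finset.mem_filter, Finset.mem_univ,
            true_and, Finset.mem_insert]
          rw [Fin.exists_fin_succ]
          simp only [Fin.cons_zero, Fin.cons_succ, Fin.succ_pos, Fin.succ_lt_succ_iff, true_and]
          rw [eq_comm (a := v)]
          tauto
        have hset0 : Ψ ∪ (Finset.univ.filter (fun s : Fin (n + 1) => s < 0)).image
            (Fin.cons v f : Fin (n + 1) → V) = Ψ := by simp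
        rw [hset0]
        simp only [hset, Fin.cons_zero, Fin.cons_succ, Fin.val_succ, Fin.val_zero]
      rw [Finset.sum_congr rfl fun f _ => hterm f, ← Finset.mul_sum, ih', hsd,
        ← Finset.mul_prod_erase (Finset.univ \ Ψ) _ hv, mom_singleton, sandwich₂_nullMom_left]
      have := h0 v
      field_simp
    rw [Finset.sum_congr rfl fun v _ => hstep v, Finset.sum_ite_mem, Finset.univ_inter,
      ← Finset.sum_mul, sum_bracket_slashRight honshell, Finset.prod_range_succ']
    field_simp

/-- The powers `α - 2` of the ends and of the vertices in `Δ`. -/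
theorem outerWeight_empty_eq {Γ : SimpleGraph V} (hΓ : IsTreeOn Γ Finset.univ)
    (h2 : 2 ≤ Fintype.card V) (r : V → ℂ) (hr : ∀ v, r v ≠ 0) :
    outerWeight Γ r Finset.univ ∅ = (∏ η ∈ ends Γ Finset.univ, (r η)⁻¹) *
      ((branching Γ Finset.univ).map r).prod := by
  have hb : ((branching Γ Finset.univ).map r).prod = ∏ v, r v ^ (deg Γ Finset.univ v - 2) := by
    have h : ∀ S : Finset V,
        ((∑ i ∈ S, Multiset.replicate (deg Γ Finset.univ i - 2) i).map r).prod =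
          ∏ v ∈ S, r v ^ (deg Γ Finset.univ v - 2) := by
      intro S
      induction S using Finset.induction_on with
      | empty => simp
      | insert v S hv ih => simp [Finset.sum_insert hv, Finset.prod_insert hv, ih]
    exact h _
  rw [hb, ends, Finset.prod_filter, ← Finset.prod_mul_distrib]
  simp only [outerWeight, Finset.sdiff_empty, Finset.prod_empty, mul_one]
  refine Finset.prod_congr rfl fun v hv => ?_
  have hd := hΓ.1.one_le_deg (by rwa [Finset.card_univ]) hv
  have := hr v
  split_ifs with h
  · rw [h]
    field_simp
    simp
  · obtain ⟨k, hk⟩ : ∃ k, deg Γ Finset.univ v = k + 2 := ⟨deg Γ Finset.univ v - 2, by omega⟩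
    rw [hk, Nat.add_sub_cancel, one_mul, pow_add]
    field_simp

theorem phiNumerator_onshell_of_two_lt (honshell : nullMom z zt = -mom₁ x Finset.univ)
    (h0 : ∀ i, bracket z (ang x i) ≠ 0) (h1 : ∀ i, bracket (one x) (ang x i) ≠ 0)
    (hminus : ∀ S : Finset V, S.Nonempty → S ≠ Finset.univ → sqr (mom₁ x S) ≠ 0)
    (p : Spinor) {Γ : SimpleGraph V} (hΓ : IsTreeOn Γ Finset.univ) (h2 : 2 < Fintype.card V)
    (δ : ℕ → V) (hδ : Enumerates δ Γ Finset.univ) :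
    phiNumerator x p Γ δ Finset.univ =
      bracket z (one x) ^ 2 * outerWeight Γ (ratio x z) Finset.univ ∅ := by
  have hc1 : (Finset.univ : Finset V).card ≠ 1 := by rw [Finset.card_univ]; omega
  have hc2 : (Finset.univ : Finset V).card ≠ 2 := by rw [Finset.card_univ]; omega
  have hE := hΓ.two_le_card_ends (by rw [Finset.card_univ]; omega)
  set n := (ends Γ Finset.univ).card with hn
  -- the spinors `q, δ 1, …, δ (E - 2), q`, normalised
  set d : ℕ → Spinor := fun t => if t = 0 ∨ t + 1 = n then one x else
    (bracket (one x) (ang x (δ t)))⁻¹ • ang x (δ t) with hd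
  have hmain := sum_orderings_onshell honshell h0 hminus n (stem Γ Finset.univ) d
    (hΓ.stem_nonempty hc2) (by rw [sdiff_stem])
  rw [sdiff_stem, ← sum_orderings hn.symm (fun f => ∏ t, sandwich₂ (one x) (mom x {f t})
      (mom₁ x (stem Γ Finset.univ ∪ (Finset.univ.filter (fun s => s < t)).image f)) (d t) /
      sqr (mom₁ x (stem Γ Finset.univ ∪ (Finset.univ.filter (fun s => s < t)).image f)))]
    at hmain
  have hlhs : phiNumerator x p Γ δ Finset.univ = ∑ η : Fin n ≃ ends Γ Finset.univ,
      ∏ t, sandwich₂ (one x) (mom x {(η t : V)}) (mom₁ x (stem Γ Finset.univ ∪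
        (Finset.univ.filter (fun s => s < t)).image (fun s => (η s : V)))) (d t) /
      sqr (mom₁ x (stem Γ Finset.univ ∪
        (Finset.univ.filter (fun s => s < t)).image (fun s => (η s : V)))) := by
    rw [phiNumerator, if_neg hc1, if_neg hc2]
    refine Finset.sum_congr rfl fun η _ => Finset.prod_congr rfl fun t _ => ?_
    simp only [hd]
    unfold grown
    split_ifs with ht
    · rw [sandwich₂_mom₁_one]
    · rw [sandwich₂_smul_right]
      have := h1 (δ t)
      field_simp
      rfl
  rw [hlhs, hmain, outerWeight_empty_eq hΓ h2.le (ratio x z) fun v => div_ne_zero (h0 v) (h1 v)]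
  have hleaves : ∏ k ∈ ends Γ Finset.univ, bracket (one x) (ang x k) / bracket z (ang x k) =
      ∏ η ∈ ends Γ Finset.univ, (ratio x z η)⁻¹ :=
    Finset.prod_congr rfl fun k _ => by rw [ratio, inv_div]
  have hbranch : ∏ t ∈ Finset.range n, bracket z (d t) =
      bracket z (one x) ^ 2 * ((branching Γ Finset.univ).map (ratio x z)).prod := by
    rw [← hδ, Multiset.map_map]
    obtain ⟨m, hm⟩ : ∃ m, n = m + 2 := ⟨n - 2, by omega⟩
    have e1 : ∀ t ∈ Finset.range m, bracket z (d (t + 1)) = ratio x z (δ (t + 1)) := by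
      intro t ht
      rw [Finset.mem_range] at ht
      have : ¬ (t + 1 = 0 ∨ t + 1 + 1 = n) := by omega
      simp only [hd]
      rw [if_neg this, ratio]
      simp [bracket]
      ring
    have e2 : Finset.Icc 1 (n - 2) = (Finset.range m).image (· + 1) := by
      ext t
      simp only [Finset.mem_Icc, Finset.mem_image, Finset.mem_range]
      constructor
      · rintro ⟨h1, h2⟩
        exact ⟨t - 1, by omega, by omega⟩
      · rintro ⟨s, h1, rfl⟩
        omega
    have e3 : (Multiset.map (ratio x z ∘ δ) (Finset.Icc 1 (n - 2)).val).prod =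
        ∏ t ∈ Finset.Icc 1 (n - 2), ratio x z (δ t) := rfl
    have e4 : d (m + 1) = one x := if_pos (Or.inr (by omega))
    have e5 : d 0 = one x := if_pos (Or.inl rfl)
    rw [← hn, e3, e2, Finset.prod_image (by intro a _ b _ h; simpa using h), hm,
      Finset.prod_range_succ, Finset.prod_range_succ', Finset.prod_congr rfl e1, e4, e5]
    ring
  rw [hleaves, hbranch]
  ring

theorem phiNumerator_onshell_of_eq_two (honshell : nullMom z zt = -mom₁ x Finset.univ)
    (h0 : ∀ i, bracket z (ang x i) ≠ 0)
    (hminus : ∀ S : Finset V, S.Nonempty → S ≠ Finset.univ → sqr (mom₁ x S) ≠ 0)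
    (p : Spinor) {Γ : SimpleGraph V} (hΓ : IsTreeOn Γ Finset.univ) (h2 : Fintype.card V = 2)
    (δ : ℕ → V) : phiNumerator x p Γ δ Finset.univ =
      bracket z (one x) ^ 2 * outerWeight Γ (ratio x z) Finset.univ ∅ := by
  have hc2 : (Finset.univ : Finset V).card = 2 := by rw [Finset.card_univ, h2]
  have hdeg : ∀ v, deg Γ Finset.univ v = 1 := by
    intro v
    by_contra hv
    have hlt : ∑ v : V, 1 < ∑ v, deg Γ Finset.univ v :=
      Finset.sum_lt_sum (fun v hv => hΓ.1.one_le_deg hc2.ge hv) ⟨v, Finset.mem_univ v, by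
        have := hΓ.1.one_le_deg hc2.ge (Finset.mem_univ v)
        omega⟩
    have := hΓ.2
    simp at hlt
    omega
  obtain ⟨a, b, hab, huniv⟩ := Finset.card_eq_two.1 hc2
  have hfac : ∀ i j : V, i ≠ j → (Finset.univ : Finset V) = {i, j} →
      sandwich₂ (one x) (mom x {i}) (mom x {j}) (one x) / sqr (mom₁ x {i}) =
        -(bracket z (one x) * (ratio x z j)⁻¹) := by
    intro i j hij hu
    have hsd : Finset.univ \ {i} = ({j} : Finset V) := by
      rw [hu]
      ext k
      simp only [Finset.mem_sdiff, Finset.mem_insert, Finset.mem_singleton]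
      constructor
      · rintro ⟨h | h, h'⟩
        · exact absurd h h'
        · exact h
      · rintro rfl
        exact ⟨Or.inr rfl, hij.symm⟩
    have hs := sum_bracket_slashRight honshell (one x) {i}
    rw [hsd, Finset.sum_singleton] at hs
    have hne : sqr (mom₁ x {i}) ≠ 0 := hminus {i} (by simp) (by
      intro h'
      have := Finset.mem_univ j
      rw [← h', Finset.mem_singleton] at this
      exact hij this.symm)
    have hsw : sandwich₂ (one x) (mom x {i}) (mom x {j}) (one x) =
        -(bracket (one x) (ang x j) *
          bracket (squ x j) (slashRight (mom₁ x {i}) (one x))) := by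
      rw [← sandwich₂_nullMom_left, sandwich₂_mom₁_one, ← mom_singleton, sandwich₂_mom_mom,
        sandwich₂_mom_mom]
      simp [bracket]
      ring
    have := h0 j
    rw [hsw, ratio, inv_div, div_eq_iff hne]
    field_simp
    linear_combination (-bracket (one x) (ang x j)) * hs
  have hba : (Finset.univ : Finset V) = {b, a} := by rw [huniv, Finset.pair_comm]
  have ea : (Finset.univ : Finset V).erase a = {b} := by
    rw [huniv, Finset.erase_insert (by simpa using hab)]
  have eb : (Finset.univ : Finset V).erase b = {a} := by
    rw [hba, Finset.erase_insert (by simpa using hab.symm)]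
  rw [phiNumerator, if_neg (by omega), if_pos hc2]
  have hp : ∀ g : V → ℂ, ∏ v, g v = g a * g b := fun g => by
    rw [huniv, Finset.prod_pair hab]
  rw [hp, ea, eb, hfac a b hab huniv, hfac b a hab.symm hba]
  simp only [outerWeight, Finset.sdiff_empty, Finset.prod_empty, mul_one, hdeg, hp]
  have h1 : ∀ v, ratio x z v * (ratio x z v ^ 2)⁻¹ = (ratio x z v)⁻¹ := by
    intro v
    by_cases hv : ratio x z v = 0
    · simp [hv]
    · field_simp
  simp only [pow_one, h1]
  ring

/-- The residue of the top term. For a single positive helicity graviton, it is the amputated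
current itself. -/
theorem phiNumerator_onshell (honshell : nullMom z zt = -mom₁ x Finset.univ)
    (h01 : bracket z (one x) ≠ 0)
    (h0 : ∀ i, bracket z (ang x i) ≠ 0) (h1 : ∀ i, bracket (one x) (ang x i) ≠ 0)
    (hminus : ∀ S : Finset V, S.Nonempty → S ≠ Finset.univ → sqr (mom₁ x S) ≠ 0)
    (p : Spinor) (hp₁ : bracket (oneT x) p ≠ 0) {Γ : SimpleGraph V}
    (hΓ : IsTreeOn Γ Finset.univ) (δ : ℕ → V) (hδ : Enumerates δ Γ Finset.univ) :
    phiNumerator x p Γ δ Finset.univ =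
      bracket z (one x) ^ 2 * outerWeight Γ (ratio x z) Finset.univ ∅ := by
  have hpos : 0 < Fintype.card V := by
    rw [← Finset.card_univ]
    exact hΓ.1.nonempty.card_pos
  rcases lt_trichotomy (Fintype.card V) 2 with h | h | h
  · have hc : (Finset.univ : Finset V).card = 1 := by rw [Finset.card_univ]; omega
    rw [← treeNumerator_onshell honshell h01 h0 h1 hminus p hp₁ hΓ, phiNumerator, if_pos hc,
      treeNumerator, Finset.sum_eq_zero, add_zero]
    intro I hI
    obtain ⟨hIu, hne, hne'⟩ := mem_ssubsets_erase.1 hI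
    have := Finset.card_sdiff_add_card_eq_card hIu
    have := hne.card_pos
    have := hne'.card_pos
    omega
  · exact phiNumerator_onshell_of_eq_two honshell h0 hminus p hΓ h δ
  · exact phiNumerator_onshell_of_two_lt honshell h0 h1 hminus p hΓ h δ hδ

end

/-! ### Continuity in the kinematics -/

section

variable {X : Type*} [TopologicalSpace X]

theorem continuous_bracket {f g : X → Spinor} (hf : Continuous f) (hg : Continuous g) :
    Continuous fun y => bracket (f y) (g y) := by
  unfold bracket
  fun_prop

theorem continuous_sqr {P : X → Momentum} (hP : Continuous P) :
    Continuous fun y => sqr (P y) := by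
  simp only [sqr_eq]
  have h : ∀ i j, Continuous fun y => P y i j := fun i j => hP.matrix_elem i j
  exact ((h 0 0).mul (h 1 1)).sub ((h 0 1).mul (h 1 0))

theorem continuous_slashLeft {l : X → Spinor} {P : X → Momentum} (hl : Continuous l)
    (hP : Continuous P) : Continuous fun y => slashLeft (l y) (P y) :=
  continuous_pi fun A' => continuous_bracket hl (continuous_pi fun A => hP.matrix_elem A A')

theorem continuous_slashRight {P : X → Momentum} {m : X → Spinor} (hP : Continuous P)
    (hm : Continuous m) : Continuous fun y => slashRight (P y) (m y) :=
  continuous_pi fun A' => continuous_bracket (continuous_pi fun A => hP.matrix_elem A A') hm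

theorem continuous_sandwich₁ {l m : X → Spinor} {P : X → Momentum} (hl : Continuous l)
    (hP : Continuous P) (hm : Continuous m) :
    Continuous fun y => sandwich₁ (l y) (P y) (m y) :=
  continuous_bracket (continuous_slashLeft hl hP) hm

theorem continuous_sandwich₂ {l m : X → Spinor} {P Q : X → Momentum} (hl : Continuous l)
    (hP : Continuous P) (hQ : Continuous Q) (hm : Continuous m) :
    Continuous fun y => sandwich₂ (l y) (P y) (Q y) (m y) :=
  continuous_bracket (continuous_slashLeft hl hP) (continuous_slashRight hQ hm)

theorem continuous_nullMom {l m : X → Spinor} (hl : Continuous l) (hm : Continuous m) :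
    Continuous fun y => nullMom (l y) (m y) :=
  hl.matrix_vecMulVec hm

end

section

variable {V : Type*}

theorem continuous_angOne : Continuous fun x : Kinematics V => one x :=
  (continuous_apply (none : Option V)).fst

theorem continuous_squOne : Continuous fun x : Kinematics V => oneT x :=
  (continuous_apply (none : Option V)).snd

theorem continuous_ang (i : V) : Continuous fun x : Kinematics V => ang x i :=
  (continuous_apply (some i)).fst

theorem continuous_squ (i : V) : Continuous fun x : Kinematics V => squ x i :=
  (continuous_apply (some i)).snd

theorem continuous_mom (S : Finset V) : Continuous fun x : Kinematics V => mom x S :=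
  continuous_finsetSum S fun i _ => continuous_nullMom (continuous_ang i) (continuous_squ i)

theorem continuous_mom₁ (S : Finset V) : Continuous fun x : Kinematics V => mom₁ x S :=
  (continuous_nullMom continuous_angOne continuous_squOne).add (continuous_mom S)

end

section

open scoped Classical

variable {V : Type*} {x₀ : Kinematics V}

theorem continuousAt_plusCurrent (h1 : ∀ i, bracket (one x₀) (ang x₀ i) ≠ 0)
    (hplus : ∀ S : Finset V, 2 ≤ S.card → sqr (mom x₀ S) ≠ 0) (S : Finset V) :
    S.Nonempty → ContinuousAt (fun x => plusCurrent x S) x₀ := by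
  induction S using Finset.strongInduction with
  | H S ih =>
    intro hS
    by_cases hc : S.card = 1
    · obtain ⟨i, rfl⟩ := Finset.card_eq_one.1 hc
      simp only [plusCurrent_singleton]
      exact ((continuous_bracket continuous_angOne (continuous_ang i)).continuousAt.pow 4).inv₀
        (pow_ne_zero 4 (h1 i))
    · simp only [plusCurrent_of_card_ne_one _ hc]
      have h2 : 2 ≤ S.card := by
        have := hS.card_pos
        omega
      refine ((continuous_sqr (continuous_mom S)).continuousAt.inv₀ (hplus S h2)).mul
        (continuousAt_const.mul (tendsto_finsetSum _ fun I hI => ?_))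
      have hI' := mem_ssubsets_erase.1 hI
      refine (ContinuousAt.mul (ContinuousAt.mul (ContinuousAt.pow ?_ 2) ?_) ?_)
      · exact (continuous_sandwich₂ continuous_angOne (continuous_mom _) (continuous_mom _)
          continuous_angOne).continuousAt
      · exact ih I (Finset.mem_ssubsets.1 (Finset.mem_erase.1 hI).2) hI'.2.1
      · exact ih _ (Finset.sdiff_ssubset hI'.1 hI'.2.1) hI'.2.2

theorem continuousAt_minusSource (p : Spinor) (hp₁ : bracket (oneT x₀) p ≠ 0) (S : Finset V) :
    ContinuousAt (fun x => minusSource x p S) x₀ :=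
  ((continuous_sandwich₁ continuous_angOne (continuous_mom S)
    continuous_const).continuousAt.pow 2).div
    ((continuous_bracket continuous_squOne continuous_const).continuousAt.pow 2)
    (pow_ne_zero 2 hp₁)

theorem notMem_grown {Γ : SimpleGraph V} {I : Finset V} (η : Fin (ends Γ I).card ≃ ends Γ I)
    (t : Fin (ends Γ I).card) : (η t : V) ∉ grown Γ I η t := by
  intro h
  rcases Finset.mem_union.1 h with h | h
  · exact Finset.disjoint_left.1 (disjoint_stem_ends Γ I) h (η t).2
  · obtain ⟨s, hs, hst⟩ := Finset.mem_image.1 h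
    rw [η.injective (Subtype.val_injective hst), Finset.mem_filter] at hs
    exact lt_irrefl _ hs.2

theorem bracket_ang_ne_zero (hplus : ∀ S : Finset V, 2 ≤ S.card → sqr (mom x₀ S) ≠ 0) (i j : V)
    (hij : i ≠ j) : bracket (ang x₀ i) (ang x₀ j) ≠ 0 := by
  have h := hplus {i, j} (Finset.card_pair hij).ge
  rw [mom, Finset.sum_pair hij, sqr_nullMom_add_nullMom] at h
  exact left_ne_zero_of_mul h

variable [Fintype V]

theorem continuousAt_oneMinusNumerator (h1 : ∀ i, bracket (one x₀) (ang x₀ i) ≠ 0)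
    (hplus : ∀ S : Finset V, 2 ≤ S.card → sqr (mom x₀ S) ≠ 0)
    (hminus : ∀ S : Finset V, S.Nonempty → S ≠ Finset.univ → sqr (mom₁ x₀ S) ≠ 0)
    (p : Spinor) (hp₁ : bracket (oneT x₀) p ≠ 0) (S : Finset V) :
    S.Nonempty → ContinuousAt (fun x => oneMinusNumerator x p S) x₀ := by
  induction S using Finset.strongInduction with
  | H S ih =>
    intro hS
    refine ((continuousAt_minusSource p hp₁ S).mul
      (continuousAt_plusCurrent h1 hplus S hS)).add (tendsto_finsetSum _ fun I hI => ?_)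
    have hI' := mem_ssubsets_erase.1 hI
    have hss := Finset.mem_ssubsets.1 (Finset.mem_erase.1 hI).2
    refine (ContinuousAt.mul (ContinuousAt.mul (ContinuousAt.pow ?_ 2) ?_) ?_)
    · exact (continuous_sandwich₂ continuous_angOne (continuous_mom _) (continuous_mom _)
        continuous_angOne).continuousAt
    · simp only [oneMinusCurrent_eq]
      exact ((continuous_sqr (continuous_mom₁ I)).continuousAt.inv₀
        (hminus I hI'.2.1 (hss.trans_le (Finset.subset_univ S)).ne)).mul (ih I hss hI'.2.1)
    · exact continuousAt_plusCurrent h1 hplus _ hI'.2.2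

/-- No propagator of `φ(Γ_I)` other than the first one has a pole. -/
theorem continuousAt_phiNumerator (h1 : ∀ i, bracket (one x₀) (ang x₀ i) ≠ 0)
    (hminus : ∀ S : Finset V, S.Nonempty → S ≠ Finset.univ → sqr (mom₁ x₀ S) ≠ 0)
    (p : Spinor) (hp₁ : bracket (oneT x₀) p ≠ 0) {Γ : SimpleGraph V} {I : Finset V}
    (hI : IsTreeOn Γ I) (δ : ℕ → V) :
    ContinuousAt (fun x => phiNumerator x p Γ δ I) x₀ := by
  unfold phiNumerator
  split_ifs with hc1 hc2
  · exact continuousAt_minusSource p hp₁ I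
  · refine tendsto_finsetProd _ fun i hi => ?_
    refine ContinuousAt.div (continuous_sandwich₂ continuous_angOne (continuous_mom _)
      (continuous_mom _) continuous_angOne).continuousAt
      (continuous_sqr (continuous_mom₁ _)).continuousAt (hminus _ (by simp) ?_)
    intro h
    have := Finset.card_le_card (Finset.subset_univ I)
    rw [← h, Finset.card_singleton] at this
    omega
  · refine tendsto_finsetSum _ fun η _ => tendsto_finsetProd _ fun t _ => ?_
    have hne : sqr (mom₁ x₀ (grown Γ I η t)) ≠ 0 := by
      refine hminus _ ((hI.stem_nonempty hc2).mono Finset.subset_union_left) fun h => ?_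
      exact notMem_grown η t (h ▸ Finset.mem_univ _)
    split_ifs
    · exact ContinuousAt.div (continuous_sandwich₂ continuous_angOne (continuous_mom _)
        (continuous_mom _) continuous_angOne).continuousAt
        (continuous_sqr (continuous_mom₁ _)).continuousAt hne
    · exact ContinuousAt.div (continuous_sandwich₂ continuous_angOne (continuous_mom _)
        (continuous_mom₁ _) (continuous_ang _)).continuousAt
        ((continuous_sqr (continuous_mom₁ _)).mul
          (continuous_bracket continuous_angOne (continuous_ang _))).continuousAt
        (mul_ne_zero hne (h1 _))

theorem continuousAt_treeWeight (h1 : ∀ i, bracket (one x₀) (ang x₀ i) ≠ 0)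
    (hne : ∀ i j, i ≠ j → bracket (ang x₀ i) (ang x₀ j) ≠ 0) (Γ : SimpleGraph V) :
    ContinuousAt (fun x => treeWeight x Γ) x₀ := by
  unfold treeWeight
  refine ContinuousAt.mul (tendsto_finsetProd _ fun i _ => ?_) (tendsto_finsetProd _ fun e he => ?_)
  · exact (continuous_bracket continuous_angOne (continuous_ang i)).continuousAt.zpow₀ _
      (Or.inl (h1 i))
  · induction e with
    | _ i j =>
      rw [SimpleGraph.mem_edgeFinset, SimpleGraph.mem_edgeSet] at he
      exact (continuous_bracket (continuous_squ i) (continuous_squ j)).continuousAt.div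
        (continuous_bracket (continuous_ang i) (continuous_ang j)).continuousAt
        (hne i j he.ne)

/-! ### Limits at the on-shell point -/

/-- Varying the primed spinor of the graviton `1` moves the momentum `0` off shell. -/
theorem neBot_offShell {z zt p : Spinor} (honshell : nullMom z zt = -mom₁ x₀ Finset.univ)
    (hp₀ : bracket zt p ≠ 0) (h01 : bracket z (one x₀) ≠ 0) : (offShell x₀).NeBot := by
  rw [offShell, ← mem_closure_iff_nhdsWithin_neBot]
  set y : ℂ → Kinematics V := fun e => Function.update x₀ none (one x₀, oneT x₀ + e • p) with hy
  have hcont : Continuous y := by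
    refine continuous_const.update none (continuous_const.prodMk ?_)
    exact continuous_const.add (continuous_id.smul continuous_const)
  have hy0 : y 0 = x₀ := by
    simp only [hy, zero_smul, add_zero]
    exact Function.update_eq_self none x₀
  have hlim : Tendsto y (𝓝[≠] 0) (𝓝 x₀) := by
    have := hcont.tendsto 0
    rw [hy0] at this
    exact this.mono_left nhdsWithin_le_nhds
  refine mem_closure_of_tendsto hlim ?_
  filter_upwards [self_mem_nhdsWithin] with e he
  have hone : one (y e) = one x₀ := by simp [hy, one]
  have honeT : oneT (y e) = oneT x₀ + e • p := by simp [hy, oneT]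
  have hmom : mom (y e) Finset.univ = mom x₀ Finset.univ := by
    simp [mom, hy, ang, squ]
  have hsum : mom₁ (y e) Finset.univ = nullMom z (-zt) + nullMom (one x₀) (e • p) := by
    have h2 : nullMom z (-zt) = mom₁ x₀ Finset.univ := by
      rw [← neg_neg (mom₁ x₀ Finset.univ), ← honshell]
      simp [nullMom]
    rw [h2, mom₁, mom₁, hone, honeT, hmom]
    simp only [nullMom, Matrix.vecMulVec_add]
    abel
  have hval : sqr (mom₁ (y e) Finset.univ) = -(e * (bracket z (one x₀) * bracket zt p)) := by
    rw [hsum, sqr_nullMom_add_nullMom]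
    simp [bracket]
    ring
  change sqr (mom₁ (y e) Finset.univ) ≠ 0
  rw [hval]
  exact neg_ne_zero.2 (mul_ne_zero he (mul_ne_zero h01 hp₀))

theorem amputated_eq (z zt p : Spinor) (x : Kinematics V) :
    amputated z zt p x = bracket z (one x) ^ 2 *
      (sandwich₁ (one x) (mom₁ x Finset.univ) p ^ 2 / bracket p zt ^ 2) *
      (sqr (mom₁ x Finset.univ) * oneMinusCurrent x p Finset.univ) := by
  simp only [amputated, polMinus, currentTensor, sandwich₁, Fin.sum_univ_two, raise,
    bracket, Matrix.cons_val_zero, Matrix.cons_val_one]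
  ring

/-- The factors of a single tree in the tree formula. -/
theorem outerWeight_mul_treeWeight {z : Spinor} (h0 : ∀ i, bracket z (ang x₀ i) ≠ 0)
    (h1 : ∀ i, bracket (one x₀) (ang x₀ i) ≠ 0) (Γ : SimpleGraph V) :
    outerWeight Γ (ratio x₀ z) Finset.univ ∅ * treeWeight x₀ Γ =
      (∏ i, bracket z (ang x₀ i) ^ ((Γ.degree i : ℤ) - 2) *
        bracket (one x₀) (ang x₀ i) ^ ((Γ.degree i : ℤ) - 2)) *
      ∏ e ∈ Γ.edgeFinset, edgeFactor x₀ e := by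
  unfold treeWeight
  rw [← mul_assoc]
  congr 1
  simp only [outerWeight, Finset.sdiff_empty, Finset.prod_empty, mul_one, deg_univ]
  rw [← Finset.prod_mul_distrib]
  refine Finset.prod_congr rfl fun i _ => ?_
  have a := h0 i
  have b := h1 i
  have h2 : (2 * (Γ.degree i : ℤ) - 4) = ((Γ.degree i : ℤ) - 2) + ((Γ.degree i : ℤ) - 2) := by ring
  have h3 : ratio x₀ z i ^ Γ.degree i * (ratio x₀ z i ^ 2)⁻¹ =
      ratio x₀ z i ^ ((Γ.degree i : ℤ) - 2) := by
    have hr : ratio x₀ z i ≠ 0 := div_ne_zero a b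
    rw [zpow_sub₀ hr, zpow_natCast, div_eq_mul_inv]
    norm_cast
  rw [h3, h2, zpow_add₀ b, ratio, div_zpow]
  have := zpow_ne_zero ((Γ.degree i : ℤ) - 2) b
  field_simp

end

end GravityMHV

theorem mainTheorem2 {V : Type*} [Fintype V] [DecidableEq V] [Nonempty V]
    (p z zt : Spinor) (x₀ : Kinematics V)
    -- the momentum `0 = -(1+K)` is null, equal to `|z)[zt|`
    (honshell : nullMom z zt = -mom₁ x₀ Finset.univ)
    -- admissible reference spinor
    (hp₁ : bracket (oneT x₀) p ≠ 0) (hp₀ : bracket zt p ≠ 0)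
    -- generic kinematics
    (h01 : bracket z (one x₀) ≠ 0)
    (h0 : ∀ i, bracket z (ang x₀ i) ≠ 0) (h1 : ∀ i, bracket (one x₀) (ang x₀ i) ≠ 0)
    (hplus : ∀ S : Finset V, 2 ≤ S.card → sqr (mom x₀ S) ≠ 0)
    (hminus : ∀ S : Finset V, S.Nonempty → S ≠ Finset.univ → sqr (mom₁ x₀ S) ≠ 0)
    -- enumerations of the branching vertices of all the subtrees
    (δ : SimpleGraph V → Finset V → ℕ → V)
    (hδ : ∀ Γ ∈ spanningTrees V, ∀ I, IsSubtree Γ I → Enumerates (δ Γ I) Γ I) :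
    -- off-shell kinematics do accumulate at `x₀`
    (offShell x₀).NeBot ∧
    -- for every tree, only the top term of `Φ(Γ)` has a pole
    (∀ Γ ∈ spanningTrees V,
      (∀ I, IsSubtree Γ I → I ≠ Finset.univ →
        Tendsto (fun x => sqr (mom₁ x Finset.univ) * phi x p Γ (δ Γ I) I) (offShell x₀) (𝓝 0)) ∧
      Tendsto (fun x => sqr (mom₁ x Finset.univ) *
        (Phi x p Γ (δ Γ) - phi x p Γ (δ Γ Finset.univ) Finset.univ)) (offShell x₀) (𝓝 0)) ∧
    -- only the top terms contribute to the residue of the current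
    Tendsto (fun x => sqr (mom₁ x Finset.univ) * (oneMinusCurrent x p Finset.univ -
        ∑ Γ ∈ spanningTrees V, phi x p Γ (δ Γ Finset.univ) Finset.univ * treeWeight x Γ))
      (offShell x₀) (𝓝 0) ∧
    -- the residue of the top term
    (2 ≤ Fintype.card V → ∀ Γ ∈ spanningTrees V,
      Tendsto (fun x => sqr (mom₁ x Finset.univ) * phi x p Γ (δ Γ Finset.univ) Finset.univ)
        (offShell x₀)
        (𝓝 (bracket z (one x₀) ^ 2 *
          (∏ η ∈ ends Γ Finset.univ, bracket (one x₀) (ang x₀ η) / bracket z (ang x₀ η)) *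
          ((branching Γ Finset.univ).map
            (fun d => bracket z (ang x₀ d) / bracket (one x₀) (ang x₀ d))).prod))) ∧
    -- multiplying by `J(Γ)` and summing over the trees
    Tendsto (fun x => bracket z (one x) ^ 4 * ∑ Γ ∈ spanningTrees V,
        sqr (mom₁ x Finset.univ) * phi x p Γ (δ Γ Finset.univ) Finset.univ * treeWeight x Γ)
      (offShell x₀) (𝓝 (mhvFormula x₀ z)) ∧
    -- the amplitude
    Tendsto (amputated z zt p) (offShell x₀) (𝓝 (mhvFormula x₀ z)) := by
  -- the trees are defined with classical decidability, so the currents are brought to it as well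
  obtain rfl : ‹DecidableEq V› = fun a b => Classical.propDecidable (a = b) :=
    Subsingleton.elim _ _
  classical
  have hne := bracket_ang_ne_zero hplus
  have hunivne : (Finset.univ : Finset V).Nonempty := Finset.univ_nonempty
  have htree : ∀ Γ ∈ spanningTrees V, IsTreeOn Γ Finset.univ := fun Γ hΓ =>
    (mem_treesOn.1 (treesOn_univ (V := V) ▸ hΓ)).2
  -- the residue of the top term of a tree
  set L : SimpleGraph V → ℂ := fun Γ =>
    bracket z (one x₀) ^ 2 * outerWeight Γ (ratio x₀ z) Finset.univ ∅ with hL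
  have hle : offShell x₀ ≤ 𝓝 x₀ := nhdsWithin_le_nhds
  have hoff : ∀ᶠ x in offShell x₀, sqr (mom₁ x Finset.univ) ≠ 0 := self_mem_nhdsWithin
  have hq : ∀ᶠ x in offShell x₀, ∀ i, bracket (one x) (ang x i) ≠ 0 := by
    refine hle (eventually_all.2 fun i => ?_)
    exact (continuous_bracket continuous_angOne (continuous_ang i)).continuousAt.eventually_ne (h1 i)
  have hsq0 : sqr (mom₁ x₀ (Finset.univ : Finset V)) = 0 := by
    rw [← sqr_neg, ← honshell, sqr_nullMom]
  have hbox : Tendsto (fun x : Kinematics V => sqr (mom₁ x Finset.univ)) (offShell x₀) (𝓝 0) := by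
    have := (continuous_sqr (continuous_mom₁ (Finset.univ : Finset V))).tendsto x₀
    rw [hsq0] at this
    exact this.mono_left hle
  have htop : ∀ Γ ∈ spanningTrees V, Tendsto (fun x => sqr (mom₁ x Finset.univ) *
      phi x p Γ (δ Γ Finset.univ) Finset.univ) (offShell x₀) (𝓝 (L Γ)) := by
    intro Γ hΓ
    have hc := continuousAt_phiNumerator h1 hminus p hp₁ (htree Γ hΓ) (δ Γ Finset.univ)
    have hv := phiNumerator_onshell honshell h01 h0 h1 hminus p hp₁ (htree Γ hΓ)
      (δ Γ Finset.univ) (hδ Γ hΓ _ (htree Γ hΓ).1)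
    have ht := hc.tendsto.mono_left hle
    rw [hv] at ht
    refine ht.congr' ?_
    filter_upwards [hoff, hq] with x hx hqx
    rw [phi_eq hqx, mul_inv_cancel_left₀ hx]
  -- for a proper subtree, `1/(1+I)^2` is continuous at `x₀`
  have hsub : ∀ Γ ∈ spanningTrees V, ∀ I, IsSubtree Γ I → I ≠ Finset.univ →
      Tendsto (fun x => sqr (mom₁ x Finset.univ) * phi x p Γ (δ Γ I) I) (offShell x₀) (𝓝 0) := by
    intro Γ hΓ I hI hIu
    have hc := continuousAt_phiNumerator h1 hminus p hp₁
      ((htree Γ hΓ).of_subset hI (Finset.subset_univ I)) (δ Γ I)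
    have hs := (continuous_sqr (continuous_mom₁ I)).continuousAt.inv₀ (hminus I hI.nonempty hIu)
    have ht := hbox.mul ((hs.mul hc).tendsto.mono_left hle)
    rw [zero_mul] at ht
    refine ht.congr' ?_
    filter_upwards [hq] with x hqx
    rw [phi_eq hqx]
    rfl
  have hwt : ∀ Γ, Tendsto (fun x => treeWeight x Γ) (offShell x₀) (𝓝 (treeWeight x₀ Γ)) :=
    fun Γ => (continuousAt_treeWeight h1 hne Γ).tendsto.mono_left hle
  have hsum : Tendsto (fun x => ∑ Γ ∈ spanningTrees V, sqr (mom₁ x Finset.univ) *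
      phi x p Γ (δ Γ Finset.univ) Finset.univ * treeWeight x Γ) (offShell x₀)
      (𝓝 (∑ Γ ∈ spanningTrees V, L Γ * treeWeight x₀ Γ)) :=
    tendsto_finsetSum _ fun Γ hΓ => (htop Γ hΓ).mul (hwt Γ)
  -- the residue of the current is the same sum over the trees
  have hcur : Tendsto (fun x => sqr (mom₁ x Finset.univ) * oneMinusCurrent x p Finset.univ)
      (offShell x₀) (𝓝 (∑ Γ ∈ spanningTrees V, L Γ * treeWeight x₀ Γ)) := by
    have hc := continuousAt_oneMinusNumerator h1 hplus hminus p hp₁ Finset.univ hunivne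
    have ht := hc.tendsto.mono_left hle
    rw [oneMinusNumerator_eq_sum x₀ (fun k => ratio x₀ z k * (bracket (one x₀) z)⁻¹) p h1 hne
      (bracket_ang_eq h01 h1) hplus Finset.univ hunivne, treesOn_univ] at ht
    have hv : ∑ Γ ∈ spanningTrees V, treeWeightOn x₀ Γ Finset.univ *
        treeNumerator x₀ p (fun k => ratio x₀ z k * (bracket (one x₀) z)⁻¹) Γ Finset.univ =
        ∑ Γ ∈ spanningTrees V, L Γ * treeWeight x₀ Γ := by
      refine Finset.sum_congr rfl fun Γ hΓ => ?_
      rw [treeNumerator_onshell honshell h01 h0 h1 hminus p hp₁ (htree Γ hΓ), treeWeightOn_univ,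
        mul_comm]
    rw [hv] at ht
    refine ht.congr' ?_
    filter_upwards [hoff] with x hx
    rw [oneMinusCurrent_eq, mul_inv_cancel_left₀ hx]
  have hmhv : bracket z (one x₀) ^ 4 * ∑ Γ ∈ spanningTrees V, L Γ * treeWeight x₀ Γ =
      mhvFormula x₀ z := by
    rw [mhvFormula, Finset.mul_sum, Finset.mul_sum]
    refine Finset.sum_congr rfl fun Γ _ => ?_
    rw [← outerWeight_mul_treeWeight h0 h1]
    simp only [hL]
    ring
  have hz1 : Continuous fun x : Kinematics V => bracket z (one x) :=
    continuous_bracket continuous_const continuous_angOne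
  refine ⟨neBot_offShell honshell hp₀ h01, fun Γ hΓ => ⟨hsub Γ hΓ, ?_⟩, ?_, ?_, ?_, ?_⟩
  · have hu : Finset.univ ∈ (Finset.univ : Finset (Finset V)).filter (IsSubtree Γ) :=
      Finset.mem_filter.2 ⟨Finset.mem_univ _, (htree Γ hΓ).1⟩
    have ht : Tendsto (fun x => ∑ I ∈ ((Finset.univ : Finset (Finset V)).filter
        (IsSubtree Γ)).erase Finset.univ, sqr (mom₁ x Finset.univ) * phi x p Γ (δ Γ I) I)
        (offShell x₀) (𝓝 (∑ I ∈ ((Finset.univ : Finset (Finset V)).filter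
        (IsSubtree Γ)).erase Finset.univ, 0)) := by
      refine tendsto_finsetSum _ fun I hI => ?_
      rw [Finset.mem_erase, Finset.mem_filter] at hI
      exact hsub Γ hΓ I hI.2.2 hI.1
    rw [Finset.sum_const_zero] at ht
    refine ht.congr fun x => ?_
    rw [← Finset.mul_sum, Phi, ← Finset.add_sum_erase _ _ hu, add_sub_cancel_left]
  · have ht := hcur.sub hsum
    rw [sub_self] at ht
    refine ht.congr fun x => ?_
    rw [mul_sub, Finset.mul_sum]
    congr 1
    exact Finset.sum_congr rfl fun Γ _ => mul_assoc _ _ _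
  · intro h2 Γ hΓ
    have ht := htop Γ hΓ
    simp only [hL] at ht
    rw [outerWeight_empty_eq (htree Γ hΓ) h2 (ratio x₀ z)
      fun v => div_ne_zero (h0 v) (h1 v), ← mul_assoc] at ht
    simp only [ratio, inv_div] at ht
    exact ht
  · have ht := ((hz1.pow 4).tendsto x₀ |>.mono_left hle).mul hsum
    rw [← hmhv]
    exact ht
  · have hs : Continuous fun x : Kinematics V => bracket z (one x) ^ 2 *
        (sandwich₁ (one x) (mom₁ x Finset.univ) p ^ 2 / bracket p zt ^ 2) :=
      (hz1.pow 2).mul (((continuous_sandwich₁ continuous_angOne (continuous_mom₁ _)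
        continuous_const).pow 2).div_const _)
    have ht := (hs.tendsto x₀ |>.mono_left hle).mul hcur
    -- on shell, `(q|1+K|p] = -(q0)[0p]`
    have hv : bracket z (one x₀) ^ 2 *
        (sandwich₁ (one x₀) (mom₁ x₀ Finset.univ) p ^ 2 / bracket p zt ^ 2) =
        bracket z (one x₀) ^ 4 := by
      have h : mom₁ x₀ Finset.univ = -nullMom z zt := by rw [honshell, neg_neg]
      rw [h, sandwich₁_neg, sandwich₁_nullMom, bracket_swap (one x₀) z, bracket_swap p zt]
      field_simp
    rw [hv, hmhv] at ht
    exact ht.congr fun x => (amputated_eq z zt p x).symm
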